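/- A (multi-message) shuffle protocol for real summation with $n$ users consists of a local randomizer, which maps an input $x_i\in[0,1]$ to a random finite multiset of messages, and an analyzer. On a dataset $(x_1,\dots,x_n)\in[0,1]^n$ the users run the randomizer independently, the shuffler outputs all their messages in a uniformly random order, and the analyzer computes from this an estimate of $\sum_i x_i$. The protocol is $(\varepsilon,\delta)$-DP in the shuffle model if for any two datasets $X,X'$ that differ in at most one user's input and every set $S$ of possible shuffler outputs, $\Pr[\text{output on }X\in S]\le e^{\varepsilon}\Pr[\text{output on }X'\in S]+\delta$. The Laplace mechanism with parameter $a>0$ outputs $\sum_i x_i$ plus noise of density $\frac a2 e^{-a|t|}$ (so its mean squared error is $2/a^2$). Theorem. There is an absolute $k\in\mathbb N$ such that for every $E>0$ there is a constant $C>0$ depending only on $E$ with the following property. For all integers $n\ge 1$, all $0<\varepsilon\le E$ and all $\zeta,\delta\in(0,1/2)$ there is a real summation protocol for $n$ users such that: 1. it is $(\varepsilon,\delta)$-DP in the shuffle model; 2. on every dataset $(x_1,\dots,x_n)\in[0,1]^n$ the mean squared error of its output is at most that of the Laplace mechanism with parameter $(1-\zeta)\varepsilon$; 3. each user, whatever their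 input, sends in expectation at most $$1+C\left(1+\log n+\tfrac1\varepsilon+\tfrac1\zeta\right)^{k}\frac{\log(1/\delta)}{\sqrt n}$$ messages; 4. each message is a string of $b$ bits, where $b\le\frac12\log_2 n+C\log_2\frac1\zeta$. -/

import Mathlib

open scoped ENNReal

namespace ShuffleDP

noncomputable section

/-- Two datasets are neighboring iff they differ on at most a single user's input. -/
def Neighboring {X : Type*} {n : ℕ} (x x' : Fin n → X) : Prop :=
  ∃ i : Fin n, ∀ j : Fin n, j ≠ i → x j = x' j

/-- `(ε, δ)`-differential privacy of a randomized algorithm `A` (with discrete output)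
taking a dataset of `n` inputs: the probability bound holds for every pair of neighboring
datasets and every set `S` of outputs. -/
def IsDP {X Y : Type*} {n : ℕ} (A : (Fin n → X) → PMF Y) (ε δ : ℝ) : Prop :=
  ∀ x x' : Fin n → X, Neighboring x x' → ∀ S : Set Y,
    (A x).toOuterMeasure S
      ≤ ENNReal.ofReal (Real.exp ε) * (A x').toOuterMeasure S + ENNReal.ofReal δ

/-- A multi-message shuffle protocol with inputs in `X`, messages in `M` and real output:
a local randomizer, run by each user on their own input and with their own randomness, which
outputs a finite multiset of messages, and an analyzer, which sees the shuffled messages. -/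
structure Protocol (X M : Type*) where
  randomizer : X → PMF (Multiset M)
  analyzer : List M → ℝ

/-- The shuffler: the messages of the multiset `s`, arranged in an order given by a uniformly
random permutation. -/
def shuffle {M : Type*} (s : Multiset M) : PMF (List M) :=
  (PMF.uniformOfFintype (Equiv.Perm (Fin s.toList.length))).map
    fun σ => List.ofFn fun i => s.toList.get (σ i)

/-- The multiset of all the messages of all users, when the users run the local randomizer `R`
independently on their inputs. -/
def collect {X M : Type*} (R : X → PMF (Multiset M)) :
    (n : ℕ) → (Fin n → X) → PMF (Multiset M)
  | 0, _ => PMF.pure 0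
  | n + 1, x => (R (x 0)).bind fun s => (collect R n fun i => x i.succ).map fun t => s + t

namespace Protocol

variable {X M : Type*}

/-- The output of the shuffler on the dataset `x`. -/
def view (P : Protocol X M) {n : ℕ} (x : Fin n → X) : PMF (List M) :=
  (collect P.randomizer n x).bind shuffle

/-- The output of the protocol on the dataset `x`. -/
def output (P : Protocol X M) {n : ℕ} (x : Fin n → X) : PMF ℝ :=
  (P.view x).map P.analyzer

/-- A protocol run by `n` users is `(ε, δ)`-DP in the shuffle model if the output of the
shuffler is `(ε, δ)`-DP. -/
def IsShuffleDP (P : Protocol X M) (n : ℕ) (ε δ : ℝ) : Prop :=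
  IsDP (fun x : Fin n → X => P.view x) ε δ

/-- The expected number of messages sent by a user with input `a`. -/
def expectedMessages (P : Protocol X M) (a : X) : ℝ≥0∞ :=
  ∑' s : Multiset M, P.randomizer a s * (Multiset.card s : ℝ≥0∞)

end Protocol

/-- Mean squared error of an estimator with law `μ` for the true value `v`. -/
def mse (μ : MeasureTheory.Measure ℝ) (v : ℝ) : ℝ≥0∞ :=
  ∫⁻ y, ENNReal.ofReal ((y - v) ^ 2) ∂μ

/-- The Laplace distribution with density `(a / 2) * exp (-a |t|)`, for `a > 0`. -/
def laplace (a : ℝ) : MeasureTheory.Measure ℝ :=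
  MeasureTheory.volume.withDensity fun t => ENNReal.ofReal (a / 2 * Real.exp (-a * |t|))

/-- The sum of the inputs, for real summation. -/
def realSum {n : ℕ} (x : Fin n → Set.Icc (0 : ℝ) 1) : ℝ := ∑ i, (x i : ℝ)

/-- The law of the output of the Laplace mechanism with parameter `a` for real summation:
the true sum plus Laplace noise. -/
def laplaceMechanism (a : ℝ) {n : ℕ} (x : Fin n → Set.Icc (0 : ℝ) 1) :
    MeasureTheory.Measure ℝ :=
  (laplace a).map fun t => realSum x + t

end

end ShuffleDP

open scoped NNReal

namespace ShuffleDP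

noncomputable section

/-! Every user rounds `2 ^ m * x` without bias to an integer between `0` and `2 ^ m`, sends it as
one message, and adds a share of two kinds of noise. The central noise consists of geometric numbers
of messages `1` and `-1`, so its sum is discrete Laplace noise with parameter `b` about `ε / 2 ^ m`.
The flooding noise consists of negative binomial numbers of copies of zero-sum multisets ("atoms");
it does not change the sum and serves to hide everything but the sum. Negative binomial laws are
infinitely divisible (`nb_mul_nb`), so `n` independent shares with parameter scaled by `1 / n`
convolve to exactly the total noise.

Privacy rests on a combinatorial identity between multisets (`hiding_identity`): `{x} + GA = {y} +
GB + D`, where `GA` and `GB` are nonnegative combinations of `2 * m + 3` atoms each and `D` consists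
of `|x - y|` copies of `1` or of `-1`. Discrete laws form a commutative monoid under convolution, so
the argument is algebra: insert `GA` into the flooding noise, rewrite by the identity, absorb `GB`
into the flooding noise and `D` into the central noise (`indist_input`). Absorbing a shift costs
only a multiplicative factor (`indist_pure_mul_nb`). Inserting one also costs an additive error, the
probability that a negative binomial variable is small (`indist_nb_pure_mul`), exponentially small
in its shape `R`.

For accuracy, the atoms vanish under summation, leaving central noise of variance at most `2 / b ^
2` and a rounding variance of at most `1 / 4` per user. Taking `2 ^ m` of order `√n * (E + 1) / ζ`
makes the rounding term fit in the gap between parameters `(1 - ζ / 2) * ε` and `(1 - ζ) * ε`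
(`laplace_slack`). The total noise then has about `2 ^ m` messages up to the polynomial and
logarithmic factors, hence about `1 / √n` per user. -/

/-- The expectation of `f` under the discrete law `μ`. -/
def expect {α : Type*} (μ : PMF α) (f : α → ℝ≥0∞) : ℝ≥0∞ := ∑' a, μ a * f a

/-! ### Expectation calculus for discrete laws -/

section Expect

variable {α β : Type*}

theorem expect_pure (a : α) (f : α → ℝ≥0∞) : expect (PMF.pure a) f = f a := by
  unfold expect
  rw [tsum_eq_single a]
  · simp
  · intro b hb
    simp [PMF.pure_apply, hb]

theorem expect_bind (μ : PMF α) (g : α → PMF β) (f : β → ℝ≥0∞) :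
    expect (μ.bind g) f = expect μ fun a => expect (g a) f := by
  simp only [expect, PMF.bind_apply, ← ENNReal.tsum_mul_right, ← ENNReal.tsum_mul_left]
  rw [ENNReal.tsum_comm]
  simp only [mul_assoc]

theorem expect_map (μ : PMF α) (g : α → β) (f : β → ℝ≥0∞) :
    expect (μ.map g) f = expect μ fun a => f (g a) := by
  rw [← PMF.bind_pure_comp, expect_bind]
  simp only [Function.comp_apply, expect_pure]

theorem expect_const (μ : PMF α) (c : ℝ≥0∞) : expect μ (fun _ => c) = c := by
  simp [expect, ENNReal.tsum_mul_right, μ.tsum_coe]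

theorem expect_add (μ : PMF α) (f g : α → ℝ≥0∞) :
    expect μ (fun a => f a + g a) = expect μ f + expect μ g := by
  simp only [expect, mul_add, ENNReal.tsum_add]

theorem expect_mul_left (μ : PMF α) (c : ℝ≥0∞) (f : α → ℝ≥0∞) :
    expect μ (fun a => c * f a) = c * expect μ f := by
  simp only [expect, ← ENNReal.tsum_mul_left, mul_left_comm]

theorem expect_mul_right (μ : PMF α) (c : ℝ≥0∞) (f : α → ℝ≥0∞) :
    expect μ (fun a => f a * c) = expect μ f * c := by
  simp only [expect, ← ENNReal.tsum_mul_right, mul_assoc]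

theorem expect_mono (μ : PMF α) {f g : α → ℝ≥0∞} (h : ∀ a, f a ≤ g a) :
    expect μ f ≤ expect μ g :=
  ENNReal.tsum_le_tsum fun a => mul_le_mul_right (h a) _

theorem expect_comm (μ : PMF α) (ν : PMF β) (f : α → β → ℝ≥0∞) :
    expect μ (fun a => expect ν (f a)) = expect ν fun b => expect μ fun a => f a b := by
  simp only [expect, ← ENNReal.tsum_mul_left]
  rw [ENNReal.tsum_comm]
  simp only [mul_left_comm]

theorem expect_le_one (μ : PMF α) {f : α → ℝ≥0∞} (h : ∀ a, f a ≤ 1) : expect μ f ≤ 1 :=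
  (expect_mono μ h).trans (expect_const μ 1).le

theorem expect_indicator (μ : PMF α) (S : Set α) :
    expect μ (S.indicator 1) = μ.toOuterMeasure S := by
  rw [PMF.toOuterMeasure_apply]
  refine tsum_congr fun a => ?_
  by_cases h : a ∈ S <;> simp [h]

theorem pmf_ext_expect {μ ν : PMF α} (h : ∀ f, expect μ f = expect ν f) : μ = ν := by
  apply PMF.toOuterMeasure_injective
  ext S
  rw [← expect_indicator, ← expect_indicator, h]

end Expect

/-! ### The convolution monoid of discrete laws -/

section Convolution

variable {α β : Type*} [AddCommMonoid α] [AddCommMonoid β]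

/-- Discrete laws on a commutative monoid form a commutative monoid under convolution. -/
instance : CommMonoid (PMF α) where
  mul μ ν := μ.bind fun s => ν.map (s + ·)
  one := PMF.pure 0
  mul_assoc μ ν ξ := by
    refine pmf_ext_expect fun f => ?_
    change expect ((μ.bind fun s => ν.map (s + ·)).bind fun s => ξ.map (s + ·)) f =
      expect (μ.bind fun s => (ν.bind fun s => ξ.map (s + ·)).map (s + ·)) f
    simp only [expect_bind, expect_map, add_assoc]
  one_mul μ := by
    refine pmf_ext_expect fun f => ?_
    change expect ((PMF.pure 0).bind fun s => μ.map (s + ·)) f = _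
    simp only [expect_bind, expect_map, expect_pure, zero_add]
  mul_one μ := by
    refine pmf_ext_expect fun f => ?_
    change expect (μ.bind fun s => (PMF.pure 0).map (s + ·)) f = _
    simp only [expect_bind, expect_map, expect_pure, add_zero]
  mul_comm μ ν := by
    refine pmf_ext_expect fun f => ?_
    change expect (μ.bind fun s => ν.map (s + ·)) f = expect (ν.bind fun s => μ.map (s + ·)) f
    simp only [expect_bind, expect_map]
    rw [expect_comm]
    simp only [add_comm]

theorem pmf_mul_def (μ ν : PMF α) : μ * ν = μ.bind fun s => ν.map (s + ·) := rfl

theorem pmf_one_def : (1 : PMF α) = PMF.pure 0 := rfl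

theorem expect_mul (μ ν : PMF α) (f : α → ℝ≥0∞) :
    expect (μ * ν) f = expect μ fun s => expect ν fun t => f (s + t) := by
  simp only [pmf_mul_def, expect_bind, expect_map]

theorem pure_mul_pure (a b : α) : PMF.pure a * PMF.pure b = PMF.pure (a + b) :=
  pmf_ext_expect fun f => by simp only [expect_mul, expect_pure]

/-- The image of discrete laws under an additive homomorphism, as a homomorphism. -/
def mapHom (φ : α →+ β) : PMF α →* PMF β where
  toFun μ := μ.map φ
  map_one' := by simp [pmf_one_def, PMF.pure_map]
  map_mul' μ ν := pmf_ext_expect fun f => by simp only [expect_map, expect_mul, map_add]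

theorem mapHom_apply (φ : α →+ β) (μ : PMF α) : mapHom φ μ = μ.map φ := rfl

theorem expect_hom_mul (φ : α →+ ℝ≥0∞) (μ ν : PMF α) :
    expect (μ * ν) φ = expect μ φ + expect ν φ := by
  simp only [expect_mul, map_add, expect_add, expect_const]

theorem expect_hom_prod {ι : Type*} (φ : α →+ ℝ≥0∞) (s : Finset ι) (μ : ι → PMF α) :
    expect (∏ i ∈ s, μ i) φ = ∑ i ∈ s, expect (μ i) φ := by
  classical
  induction s using Finset.induction_on with
  | empty => simp [pmf_one_def, expect_pure]
  | insert i s hi ih => rw [Finset.prod_insert hi, Finset.sum_insert hi, expect_hom_mul, ih]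

theorem collect_eq_prod {X M : Type*} (R : X → PMF (Multiset M)) (n : ℕ) (x : Fin n → X) :
    collect R n x = ∏ i, R (x i) := by
  induction n with
  | zero => rfl
  | succ n ih =>
    rw [Fin.prod_univ_succ, ← ih fun i => x i.succ]
    rfl

end Convolution

/-! ### Approximate domination of laws -/

/-- `μ` is dominated by `A` times `ν` up to an additive error `d`, tested on functions with values
in `[0, 1]`. -/
def Indist {α : Type*} (μ ν : PMF α) (A d : ℝ≥0∞) : Prop :=
  ∀ f : α → ℝ≥0∞, (∀ a, f a ≤ 1) → expect μ f ≤ A * expect ν f + d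

namespace Indist

variable {α β : Type*} {μ ν ξ : PMF α} {A B d e : ℝ≥0∞}

theorem refl (μ : PMF α) : Indist μ μ 1 0 := fun f _ => by simp

theorem trans (h : Indist μ ν A d) (h' : Indist ν ξ B e) :
    Indist μ ξ (A * B) (d + A * e) := fun f hf =>
  calc expect μ f ≤ A * expect ν f + d := h f hf
    _ ≤ A * (B * expect ξ f + e) + d := by gcongr; exact h' f hf
    _ = A * B * expect ξ f + (d + A * e) := by ring

theorem mono (h : Indist μ ν A d) (hA : A ≤ B) (hd : d ≤ e) : Indist μ ν B e :=
  fun f hf => (h f hf).trans (by gcongr)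

/-- Averaging a test function over a kernel keeps its values in `[0, 1]`. Indicators are not stable
under this, which is why `Indist` tests against functions rather than sets. -/
theorem bind (h : Indist μ ν A d) (g : α → PMF β) : Indist (μ.bind g) (ν.bind g) A d :=
  fun f hf => by
    simp only [expect_bind]
    exact h _ fun a => expect_le_one _ hf

theorem map (h : Indist μ ν A d) (g : α → β) : Indist (μ.map g) (ν.map g) A d :=
  h.bind _

/-- Convexity: average the inequality over independent `x` and `y`. The mixing laws need not be
related, because every pair of components is comparable. -/
theorem bind_left {γ : Type*} (ρ σ : PMF γ) {F G : γ → PMF α}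
    (h : ∀ x y, Indist (F x) (G y) A d) : Indist (ρ.bind F) (σ.bind G) A d := fun f hf => by
  have key : ∀ y, expect (ρ.bind F) f ≤ A * expect (G y) f + d := fun y => by
    rw [expect_bind]
    exact (expect_mono ρ fun x => h x y f hf).trans (expect_const ρ _).le
  calc expect (ρ.bind F) f = expect σ fun _ => expect (ρ.bind F) f := (expect_const _ _).symm
    _ ≤ expect σ fun y => A * expect (G y) f + d := expect_mono _ key
    _ = A * expect (σ.bind G) f + d := by
      rw [expect_add, expect_mul_left, expect_const, expect_bind]

theorem mul_right [AddCommMonoid α] (h : Indist μ ν A d) (ξ : PMF α) :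
    Indist (μ * ξ) (ν * ξ) A d := h.bind _

theorem mul_left [AddCommMonoid α] (h : Indist μ ν A d) (ξ : PMF α) :
    Indist (ξ * μ) (ξ * ν) A d := by
  simpa only [mul_comm ξ] using h.mul_right ξ

/-- The factors are exchanged one at a time; each exchange adds `d`, multiplied by at most the total
factor `A ^ s.card`. -/
theorem prod [AddCommMonoid α] {ι : Type*} (s : Finset ι) {μ ν : ι → PMF α} (hA : 1 ≤ A)
    (h : ∀ i ∈ s, Indist (μ i) (ν i) A d) :
    Indist (∏ i ∈ s, μ i) (∏ i ∈ s, ν i) (A ^ s.card) (s.card * A ^ s.card * d) := by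
  classical
  induction s using Finset.induction_on with
  | empty => simpa using refl 1
  | insert i s hi ih =>
    rw [Finset.prod_insert hi, Finset.prod_insert hi, Finset.card_insert_of_notMem hi]
    have h1 := (h i (Finset.mem_insert_self i s)).mul_right (∏ j ∈ s, μ j)
    have h2 := (ih fun j hj => h j (Finset.mem_insert_of_mem hj)).mul_left (ν i)
    refine (h1.trans h2).mono (pow_succ' A _).ge ?_
    calc d + A * (s.card * A ^ s.card * d)
        ≤ A ^ (s.card + 1) * d + A * (s.card * A ^ s.card * d) := by
          gcongr
          exact le_mul_of_one_le_left' (one_le_pow₀ hA)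
      _ = ((s.card + 1 : ℕ) : ℝ≥0∞) * A ^ (s.card + 1) * d := by push_cast; ring

theorem toOuterMeasure_le (h : Indist μ ν A d) (S : Set α) :
    μ.toOuterMeasure S ≤ A * ν.toOuterMeasure S + d := by
  rw [← expect_indicator, ← expect_indicator]
  refine h _ fun a => ?_
  by_cases ha : a ∈ S <;> simp [ha]

end Indist

/-! ### Negative binomial laws -/

section NegativeBinomial

open Finset.HasAntidiagonal (antidiagonal mem_antidiagonal)

/-- The generalized binomial coefficient `r (r + 1) ⋯ (r + k - 1) / k!`. -/
def nbCoeff (r : ℝ≥0) (k : ℕ) : ℝ≥0 := ∏ i ∈ Finset.range k, (r + i) / (i + 1)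

theorem succ_mul_nbCoeff_succ (r : ℝ≥0) (k : ℕ) :
    (k + 1) * nbCoeff r (k + 1) = (r + k) * nbCoeff r k := by
  rw [nbCoeff, Finset.prod_range_succ, ← nbCoeff]
  field_simp

theorem succ_mul_nbCoeff_succ' (r : ℝ≥0) (k : ℕ) :
    (k + 1) * nbCoeff r (k + 1) = r * nbCoeff (r + 1) k := by
  induction k with
  | zero => simp [nbCoeff]
  | succ k ih =>
    have h1 := succ_mul_nbCoeff_succ r (k + 1)
    have h2 := succ_mul_nbCoeff_succ (r + 1) k
    have h3 : ((k : ℝ≥0) + 1) ≠ 0 := by positivity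
    apply mul_left_cancel₀ h3
    push_cast at h1 ⊢
    calc ((k : ℝ≥0) + 1) * ((k + 1 + 1) * nbCoeff r (k + 1 + 1))
        = (r + (k + 1)) * ((k + 1) * nbCoeff r (k + 1)) := by rw [h1]; ring
      _ = r * ((r + 1 + k) * nbCoeff (r + 1) k) := by rw [ih]; ring
      _ = ((k : ℝ≥0) + 1) * (r * nbCoeff (r + 1) (k + 1)) := by rw [← h2]; ring

/-- A Vandermonde identity for real parameters. Multiplying by `k + 1 = i + j` and splitting the sum
reduces degree `k + 1` to degree `k` by the recursion of the coefficients. -/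
theorem nbCoeff_add (r s : ℝ≥0) (k : ℕ) :
    ∑ x ∈ antidiagonal k, nbCoeff r x.1 * nbCoeff s x.2 = nbCoeff (r + s) k := by
  induction k with
  | zero => simp [nbCoeff]
  | succ k ih =>
    have h3 : ((k : ℝ≥0) + 1) ≠ 0 := by positivity
    apply mul_left_cancel₀ h3
    rw [succ_mul_nbCoeff_succ, ← ih, Finset.mul_sum, Finset.mul_sum]
    have e1 : ∑ x ∈ antidiagonal (k + 1), (k + 1 : ℝ≥0) * (nbCoeff r x.1 * nbCoeff s x.2)
        = ∑ x ∈ antidiagonal (k + 1), (x.1 : ℝ≥0) * (nbCoeff r x.1 * nbCoeff s x.2)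
        + ∑ x ∈ antidiagonal (k + 1), (x.2 : ℝ≥0) * (nbCoeff r x.1 * nbCoeff s x.2) := by
      rw [← Finset.sum_add_distrib]
      refine Finset.sum_congr rfl fun x hx => ?_
      have h := mem_antidiagonal.1 hx
      have h' : (x.1 : ℝ≥0) + x.2 = k + 1 := by exact_mod_cast h
      rw [← add_mul, h']
    rw [e1, Finset.Nat.sum_antidiagonal_succ, Finset.Nat.sum_antidiagonal_succ']
    simp only [Nat.cast_zero, zero_mul, zero_add]
    rw [← Finset.sum_add_distrib]
    refine Finset.sum_congr rfl fun x hx => ?_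
    have h := mem_antidiagonal.1 hx
    have h' : (x.1 : ℝ≥0) + x.2 = k := by exact_mod_cast h
    push_cast
    calc ((x.1 : ℝ≥0) + 1) * (nbCoeff r (x.1 + 1) * nbCoeff s x.2)
          + ((x.2 : ℝ≥0) + 1) * (nbCoeff r x.1 * nbCoeff s (x.2 + 1))
        = ((x.1 : ℝ≥0) + 1) * nbCoeff r (x.1 + 1) * nbCoeff s x.2
          + nbCoeff r x.1 * (((x.2 : ℝ≥0) + 1) * nbCoeff s (x.2 + 1)) := by ring
      _ = _ := by
        rw [succ_mul_nbCoeff_succ, succ_mul_nbCoeff_succ, ← h']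
        ring

theorem nbCoeff_mono {r s : ℝ≥0} (h : r ≤ s) (k : ℕ) : nbCoeff r k ≤ nbCoeff s k :=
  Finset.prod_le_prod' fun i _ => by gcongr

/-- The unnormalized weights of the negative binomial law. -/
def nbWeight (r p : ℝ≥0) (k : ℕ) : ℝ≥0∞ := (nbCoeff r k * p ^ k : ℝ≥0)

/-- The total mass of the unnormalized negative binomial weights. -/
def nbTotal (r p : ℝ≥0) : ℝ≥0∞ := ∑' k, nbWeight r p k

theorem tsum_nbWeight_add (r s p : ℝ≥0) (f : ℕ → ℝ≥0∞) :
    ∑' i, ∑' j, nbWeight r p i * nbWeight s p j * f (i + j) =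
      ∑' k, nbWeight (r + s) p k * f k := by
  rw [← ENNReal.tsum_prod (f := fun i j => nbWeight r p i * nbWeight s p j * f (i + j)),
    ← Finset.HasAntidiagonal.sigmaAntidiagonalEquivProd.tsum_eq, ENNReal.tsum_sigma']
  refine tsum_congr fun k => ?_
  rw [tsum_fintype]
  have h : ∀ b : antidiagonal k,
      nbWeight r p b.1.1 * nbWeight s p b.1.2 * f (b.1.1 + b.1.2)
        = ((nbCoeff r b.1.1 * nbCoeff s b.1.2 : ℝ≥0) : ℝ≥0∞) * ((p ^ k : ℝ≥0) * f k) := by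
    intro b
    have hb := mem_antidiagonal.1 b.2
    rw [hb, nbWeight, nbWeight, ← ENNReal.coe_mul,
      ← mul_assoc (ENNReal.ofNNReal _), ← ENNReal.coe_mul]
    have hpk : p ^ k = p ^ b.1.1 * p ^ b.1.2 := by rw [← pow_add, hb]
    rw [hpk]
    congr 2
    ring
  refine (Finset.sum_congr rfl fun b _ => h b).trans ?_
  rw [← Finset.sum_mul, ← ENNReal.ofNNReal_finsetSum,
    Finset.sum_coe_sort (antidiagonal k) fun x => nbCoeff r x.1 * nbCoeff s x.2,
    nbCoeff_add, nbWeight, ENNReal.coe_mul, mul_assoc]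

theorem nbTotal_add (r s p : ℝ≥0) : nbTotal (r + s) p = nbTotal r p * nbTotal s p := by
  have h := tsum_nbWeight_add r s p fun _ => 1
  simp only [mul_one, ENNReal.tsum_mul_left, ENNReal.tsum_mul_right] at h
  exact h.symm

theorem nbTotal_zero (p : ℝ≥0) : nbTotal 0 p = 1 := by
  rw [nbTotal, tsum_eq_single 0]
  · simp [nbWeight, nbCoeff]
  · intro k hk
    obtain ⟨k, rfl⟩ := Nat.exists_eq_succ_of_ne_zero hk
    simp [nbWeight, nbCoeff, Finset.prod_range_succ']

theorem nbCoeff_one (k : ℕ) : nbCoeff 1 k = 1 :=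
  Finset.prod_eq_one fun i _ => by rw [add_comm]; exact div_self (by positivity)

theorem nbTotal_one (p : ℝ≥0) : nbTotal 1 p = (1 - p : ℝ≥0∞)⁻¹ := by
  simp [nbTotal, nbWeight, nbCoeff_one, ENNReal.tsum_geometric]

theorem nbTotal_natCast (n : ℕ) (p : ℝ≥0) : nbTotal n p = nbTotal 1 p ^ n := by
  induction n with
  | zero => simp [nbTotal_zero]
  | succ n ih => rw [Nat.cast_succ, nbTotal_add, ih, pow_succ]

/-- The weights increase with `r`, and for integral `r` the total is a power of a geometric series.
No closed form for real `r` is needed. -/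
theorem nbTotal_ne_top (r : ℝ≥0) {p : ℝ≥0} (hp : p < 1) : nbTotal r p ≠ ∞ := by
  have h : nbTotal r p ≤ nbTotal (⌈r⌉₊ : ℝ≥0) p :=
    ENNReal.tsum_le_tsum fun k =>
      ENNReal.coe_le_coe.2 (mul_le_mul_left (nbCoeff_mono (Nat.le_ceil r) k) _)
  refine ne_top_of_le_ne_top ?_ h
  rw [nbTotal_natCast, nbTotal_one]
  refine ENNReal.pow_ne_top (ENNReal.inv_ne_top.2 ?_)
  rw [ne_eq, tsub_eq_zero_iff_le, not_le]
  exact_mod_cast hp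

theorem nbTotal_ne_zero (r p : ℝ≥0) : nbTotal r p ≠ 0 := by
  refine fun h => ?_
  have := ENNReal.tsum_eq_zero.1 h 0
  simp [nbWeight, nbCoeff] at this

/-- The negative binomial law with parameters `r` and `p`. -/
def nb (r p : ℝ≥0) (hp : p < 1) : PMF ℕ :=
  PMF.normalize (nbWeight r p) (nbTotal_ne_zero r p) (nbTotal_ne_top r hp)

variable {p : ℝ≥0} (hp : p < 1)

theorem nb_apply (r : ℝ≥0) (k : ℕ) : nb r p hp k = nbWeight r p k * (nbTotal r p)⁻¹ := rfl

theorem expect_nb (r : ℝ≥0) (f : ℕ → ℝ≥0∞) :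
    expect (nb r p hp) f = (∑' k, nbWeight r p k * f k) * (nbTotal r p)⁻¹ := by
  simp only [expect, nb_apply, ← ENNReal.tsum_mul_right]
  exact tsum_congr fun k => mul_right_comm _ _ _

theorem nb_mul_nb (r s : ℝ≥0) : nb r p hp * nb s p hp = nb (r + s) p hp := by
  refine pmf_ext_expect fun f => ?_
  simp only [expect_mul, expect_nb]
  rw [← tsum_nbWeight_add, nbTotal_add,
    ENNReal.mul_inv (Or.inl (nbTotal_ne_zero r p)) (Or.inl (nbTotal_ne_top r hp))]
  simp only [← ENNReal.tsum_mul_right, ← ENNReal.tsum_mul_left]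
  refine tsum_congr fun i => tsum_congr fun j => ?_
  ring

theorem nb_zero : nb 0 p hp = 1 := by
  refine pmf_ext_expect fun f => ?_
  rw [expect_nb, nbTotal_zero, pmf_one_def, expect_pure, tsum_eq_single 0]
  · simp [nbWeight, nbCoeff]
  · intro k hk
    obtain ⟨k, rfl⟩ := Nat.exists_eq_succ_of_ne_zero hk
    simp [nbWeight, nbCoeff, Finset.prod_range_succ']

theorem nb_pow (r : ℝ≥0) (n : ℕ) : nb r p hp ^ n = nb (n * r) p hp := by
  induction n with
  | zero => simp [nb_zero]
  | succ n ih => rw [pow_succ, ih, nb_mul_nb, Nat.cast_succ, add_mul, one_mul]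

/-- The mean of the geometric law. -/
def geomMean (p : ℝ≥0) : ℝ≥0∞ := p * (1 - p : ℝ≥0∞)⁻¹

/-- Size-biasing raises the parameter by one and shifts by one. Applied repeatedly, this yields the
moments. -/
theorem expect_nb_mul (r : ℝ≥0) (f : ℕ → ℝ≥0∞) :
    expect (nb r p hp) (fun k => k * f k) =
      r * geomMean p * expect (nb (r + 1) p hp) fun k => f (k + 1) := by
  rw [expect_nb, expect_nb, tsum_eq_zero_add' ENNReal.summable]
  simp only [Nat.cast_zero, zero_mul, mul_zero, zero_add]
  have h : ∀ k : ℕ, nbWeight r p (k + 1) * (((k + 1 : ℕ) : ℝ≥0∞) * f (k + 1)) =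
      r * p * (nbWeight (r + 1) p k * f (k + 1)) := by
    intro k
    have h1 : nbWeight r p (k + 1) * ((k + 1 : ℕ) : ℝ≥0∞) = r * p * nbWeight (r + 1) p k := by
      simp only [nbWeight]
      norm_cast
      calc nbCoeff r (k + 1) * p ^ (k + 1) * ((k + 1 : ℕ) : ℝ≥0)
          = ((k + 1) * nbCoeff r (k + 1)) * p ^ (k + 1) := by push_cast; ring
        _ = _ := by rw [succ_mul_nbCoeff_succ']; ring
    rw [← mul_assoc, h1, mul_assoc]
  simp only [h, ENNReal.tsum_mul_left, geomMean, ← nbTotal_one]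
  rw [nbTotal_add, ENNReal.mul_inv (Or.inl (nbTotal_ne_zero r p)) (Or.inl (nbTotal_ne_top r hp))]
  have h1 := ENNReal.mul_inv_cancel (nbTotal_ne_zero 1 p) (nbTotal_ne_top 1 hp)
  calc _ = r * p * (∑' k, nbWeight (r + 1) p k * f (k + 1)) * (nbTotal r p)⁻¹ * 1 := by ring
    _ = _ := by rw [← h1]; ring

theorem expect_nb_id (r : ℝ≥0) : expect (nb r p hp) (fun k => (k : ℝ≥0∞)) = r * geomMean p := by
  have h := expect_nb_mul hp r fun _ => 1
  simpa [expect_const] using h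

theorem expect_nb_one_sq :
    expect (nb 1 p hp) (fun k => (k : ℝ≥0∞) * k) = geomMean p * (2 * geomMean p + 1) := by
  rw [expect_nb_mul hp 1 fun k => k]
  simp only [Nat.cast_add, Nat.cast_one, expect_add, expect_const, expect_nb_id]
  push_cast
  rw [one_mul, one_add_one_eq_two]

end NegativeBinomial

/-! ### Hiding a shift under negative binomial noise -/

/-- The number `exp (-a)`, as a nonnegative real. -/
def expNeg (a : ℝ) : ℝ≥0 := ⟨Real.exp (-a), (Real.exp_pos _).le⟩

theorem coe_expNeg (a : ℝ) : (expNeg a : ℝ) = Real.exp (-a) := rfl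

theorem expNeg_lt_one {a : ℝ} (ha : 0 < a) : expNeg a < 1 := by
  rw [← NNReal.coe_lt_coe, coe_expNeg, NNReal.coe_one, Real.exp_lt_one_iff]
  linarith

theorem ofReal_exp_eq_coe (a : ℝ) : ENNReal.ofReal (Real.exp a) = (expNeg (-a) : ℝ≥0∞) := by
  rw [← ENNReal.ofReal_coe_nnreal, coe_expNeg, neg_neg]

theorem nbCoeff_le_add {r : ℝ≥0} (hr : 1 ≤ r) (t c : ℕ) : nbCoeff r t ≤ nbCoeff r (t + c) := by
  induction c with
  | zero => exact le_rfl
  | succ c ih =>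
    refine ih.trans ?_
    rw [← add_assoc]
    have h := succ_mul_nbCoeff_succ r (t + c)
    have h3 : (0 : ℝ≥0) < ((t + c : ℕ) : ℝ≥0) + 1 := by positivity
    refine le_of_mul_le_mul_left ?_ h3
    rw [h]
    gcongr ?_ * _
    rw [add_comm]
    gcongr

/-- For `r ≥ 1` the coefficients are nondecreasing, so a shift by `c` loses at most the power `exp
(-a) ^ c`. The case `r = 1` serves the central noise. -/
theorem indist_pure_mul_nb {r : ℝ≥0} (hr : 1 ≤ r) {a : ℝ} (ha : 0 < a) (c : ℕ) :
    Indist (PMF.pure c * nb r (expNeg a) (expNeg_lt_one ha)) (nb r (expNeg a) (expNeg_lt_one ha))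
      (ENNReal.ofReal (Real.exp (a * c))) 0 := by
  intro f _
  rw [expect_mul, expect_pure, add_zero]
  set μ := nb r (expNeg a) (expNeg_lt_one ha) with hμ
  have key : ∀ t, μ t ≤ ENNReal.ofReal (Real.exp (a * c)) * μ (c + t) := by
    intro t
    simp only [hμ, nb_apply, ← mul_assoc]
    gcongr
    rw [ofReal_exp_eq_coe, nbWeight, nbWeight, ← ENNReal.coe_mul, ENNReal.coe_le_coe,
      mul_left_comm]
    have e : expNeg (-(a * c)) * expNeg a ^ (c + t) = expNeg a ^ t := by
      apply NNReal.eq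
      simp only [NNReal.coe_mul, NNReal.coe_pow, coe_expNeg, ← Real.exp_nat_mul, ← Real.exp_add]
      congr 1
      push_cast
      ring
    rw [e, add_comm c t]
    gcongr
    exact nbCoeff_le_add hr t c
  calc expect μ (fun t => f (c + t))
      ≤ ∑' t, ENNReal.ofReal (Real.exp (a * c)) * (μ (c + t) * f (c + t)) :=
        ENNReal.tsum_le_tsum fun t => by
          rw [← mul_assoc]
          exact mul_le_mul_left (key t) _
    _ = ENNReal.ofReal (Real.exp (a * c)) * ∑' t, μ (c + t) * f (c + t) := ENNReal.tsum_mul_left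
    _ ≤ _ := by
      gcongr
      exact ENNReal.tsum_comp_le_tsum_of_injective (add_right_injective c) fun t => μ t * f t

/-- Consecutive weights have ratio `(R + t) / (t + 1) * exp (-a)`. Away from small `t` this is at
most `(1 + 10 * a) * exp (-a) ≤ exp (9 * a)`. -/
theorem nbWeight_add_le {R : ℕ} {a : ℝ} (t c : ℕ) (ht : (R : ℝ) ≤ 10 * a * t) (ha : 0 < a) :
    nbWeight R (expNeg a) (t + c) ≤
      ENNReal.ofReal (Real.exp (9 * a * c)) * nbWeight R (expNeg a) t := by
  induction c with
  | zero => simp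
  | succ c ih =>
    have step : nbWeight R (expNeg a) (t + c + 1) ≤
        ENNReal.ofReal (Real.exp (9 * a)) * nbWeight R (expNeg a) (t + c) := by
      rw [ofReal_exp_eq_coe, nbWeight, nbWeight, ← ENNReal.coe_mul, ENNReal.coe_le_coe]
      have h := succ_mul_nbCoeff_succ R (t + c)
      have h3 : (0 : ℝ≥0) < ((t + c : ℕ) : ℝ≥0) + 1 := by positivity
      refine le_of_mul_le_mul_left ?_ h3
      rw [← mul_assoc, h, ← NNReal.coe_le_coe]
      simp only [NNReal.coe_mul, NNReal.coe_pow, coe_expNeg, NNReal.coe_add, NNReal.coe_natCast,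
        NNReal.coe_one, neg_neg, pow_succ]
      have hw : 0 ≤ (nbCoeff R (t + c) : ℝ) * Real.exp (-a) ^ (t + c) := by positivity
      have h1 : ((R : ℝ) + (t + c : ℕ)) * Real.exp (-a) ≤ ((t + c : ℕ) + 1) * Real.exp (9 * a) := by
        have e : Real.exp (9 * a) = Real.exp (10 * a) * Real.exp (-a) := by
          rw [← Real.exp_add]; ring_nf
        rw [e, ← mul_assoc]
        gcongr
        have h5 := Real.add_one_le_exp (10 * a)
        have h6 : 0 ≤ a * c := by positivity
        push_cast
        nlinarith
      calc _ = ((R : ℝ) + (t + c : ℕ)) * Real.exp (-a) *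
            ((nbCoeff R (t + c) : ℝ) * Real.exp (-a) ^ (t + c)) := by ring
        _ ≤ ((t + c : ℕ) + 1) * Real.exp (9 * a) *
            ((nbCoeff R (t + c) : ℝ) * Real.exp (-a) ^ (t + c)) := by gcongr
        _ = _ := by ring
    rw [← add_assoc]
    refine step.trans ((mul_le_mul_right ih _).trans ?_)
    rw [← mul_assoc, ← ENNReal.ofReal_mul (Real.exp_pos _).le, ← Real.exp_add]
    apply le_of_eq
    congr 3
    push_cast
    ring

theorem nbTotal_eq_mul (R : ℕ) {p : ℝ≥0} (hp : p < 1) :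
    nbTotal R p = nbTotal R (p ^ 2) * ((1 + p : ℝ≥0) : ℝ≥0∞) ^ R := by
  rw [nbTotal_natCast, nbTotal_natCast, ← mul_pow]
  congr 1
  have h2 : p ^ 2 < 1 := pow_lt_one₀ zero_le hp two_ne_zero
  have hsub : (1 - p : ℝ≥0) ≠ 0 := (tsub_pos_of_lt hp).ne'
  have hsub2 : (1 - p ^ 2 : ℝ≥0) ≠ 0 := (tsub_pos_of_lt h2).ne'
  rw [nbTotal_one, nbTotal_one, ← ENNReal.coe_one, ← ENNReal.coe_sub, ← ENNReal.coe_sub,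
    ← ENNReal.coe_inv hsub, ← ENNReal.coe_inv hsub2, ← ENNReal.coe_mul, ENNReal.coe_inj]
  have hm : (1 - p ^ 2 : ℝ≥0) = (1 - p) * (1 + p) := by
    apply NNReal.eq
    simp only [NNReal.coe_sub h2.le, NNReal.coe_mul, NNReal.coe_sub hp.le, NNReal.coe_pow,
      NNReal.coe_add, NNReal.coe_one]
    ring
  rw [hm]
  have : (1 + p : ℝ≥0) ≠ 0 := by positivity
  field_simp

/-- Chernoff's bound: below the cut-off, `exp (-a * t) ≤ exp (R / 5) * exp (-2 * a * t)`, and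
changing `p` to `p ^ 2` divides the total by `(1 + p) ^ R ≥ exp (R / 2)`. It remains that `1 / 5 + 1
/ 4 ≤ 1 / 2`. -/
theorem nb_tail {R T : ℕ} {a : ℝ} (ha : 0 < a) (ha4 : a ≤ 1 / 4)
    (hT : ∀ t < T, a * t ≤ R / 5) :
    (∑' t, if t < T then nb R (expNeg a) (expNeg_lt_one ha) t else 0) ≤
      ENNReal.ofReal (Real.exp (-(R / 4))) := by
  have hp := expNeg_lt_one ha
  have h1 : ∀ t, (if t < T then nb R (expNeg a) hp t else 0) ≤
      ENNReal.ofReal (Real.exp (R / 5)) * nbWeight R (expNeg a ^ 2) t *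
        (nbTotal R (expNeg a))⁻¹ := by
    intro t
    split_ifs with h
    · rw [nb_apply]
      gcongr
      rw [ofReal_exp_eq_coe, nbWeight, nbWeight, ← ENNReal.coe_mul, ENNReal.coe_le_coe,
        mul_left_comm]
      gcongr
      rw [← NNReal.coe_le_coe]
      simp only [NNReal.coe_mul, NNReal.coe_pow, coe_expNeg, ← Real.exp_nat_mul, ← Real.exp_add,
        Real.exp_le_exp, neg_neg]
      have := hT t h
      push_cast
      linarith
    · exact zero_le
  refine (ENNReal.tsum_le_tsum h1).trans ?_
  rw [ENNReal.tsum_mul_right, ENNReal.tsum_mul_left, ← nbTotal, ← div_eq_mul_inv]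
  refine ENNReal.div_le_of_le_mul ?_
  rw [nbTotal_eq_mul R hp, mul_left_comm, mul_comm (ENNReal.ofReal _)]
  gcongr
  rw [ofReal_exp_eq_coe, ofReal_exp_eq_coe, ← ENNReal.coe_pow, ← ENNReal.coe_mul,
    ENNReal.coe_le_coe, ← NNReal.coe_le_coe]
  simp only [NNReal.coe_mul, NNReal.coe_pow, coe_expNeg, neg_neg, NNReal.coe_add, NNReal.coe_one]
  have h2 : Real.exp (1 / 2) ≤ 1 + Real.exp (-a) := by
    have h3 := Real.add_one_le_exp (-a)
    have h4 : Real.exp (1 / 2) ^ 2 = Real.exp 1 := by rw [← Real.exp_nat_mul]; norm_num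
    have h5 := Real.exp_one_lt_d9
    have h6 : Real.exp (1 / 2) ≤ 7 / 4 := by
      refine le_of_pow_le_pow_left₀ two_ne_zero (by norm_num) ?_
      rw [h4]; linarith
    linarith
  calc Real.exp (R / 5) = Real.exp (-(R / 4)) * Real.exp (R * (9 / 20)) := by
        rw [← Real.exp_add]; ring_nf
    _ ≤ Real.exp (-(R / 4)) * Real.exp (R * (1 / 2)) := by
      gcongr ?_ * Real.exp (_ * ?_)
      norm_num
    _ ≤ _ := by
      rw [Real.exp_nat_mul]
      gcongr

theorem tsum_ite_le_sub (c : ℕ) (g : ℕ → ℕ → ℝ≥0∞) :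
    (∑' t, if c ≤ t then g (t - c) t else 0) = ∑' t, g t (c + t) := by
  rw [← Summable.sum_add_tsum_nat_add' (k := c) ENNReal.summable, Finset.sum_eq_zero, zero_add]
  · refine tsum_congr fun t => ?_
    rw [if_pos (Nat.le_add_left c t), Nat.add_sub_cancel, add_comm]
  · intro t ht
    rw [if_neg (not_le.2 (Finset.mem_range.1 ht))]

/-- The shifted law has no mass below `c`, so an additive error is unavoidable. Values with `a * t`
below about `R / 5` are charged to it, and the others are compared pointwise. -/
theorem indist_nb_pure_mul {R c : ℕ} {a : ℝ} (ha : 0 < a) (ha4 : a ≤ 1 / 4) (hR : 10 ≤ R)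
    (hc : a * c ≤ 1) :
    Indist (nb R (expNeg a) (expNeg_lt_one ha))
      (PMF.pure c * nb R (expNeg a) (expNeg_lt_one ha))
      (ENNReal.ofReal (Real.exp (9 * a * c))) (ENNReal.ofReal (Real.exp (-(R / 4)))) := by
  intro f hf
  rw [expect_mul, expect_pure]
  have hR' : (10 : ℝ) ≤ R := by exact_mod_cast hR
  set T := ⌊(R : ℝ) / (5 * a)⌋₊ + 1 with hTdef
  have hT : ∀ t < T, a * t ≤ R / 5 := by
    intro t ht
    have h1 : (t : ℝ) ≤ R / (5 * a) := by
      refine le_trans ?_ (Nat.floor_le (by positivity))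
      exact_mod_cast Nat.lt_succ_iff.1 ht
    rw [le_div_iff₀ (by positivity)] at h1
    linarith
  have hT' : ∀ t, T ≤ t → (R : ℝ) / 5 ≤ a * t := by
    intro t ht
    have h1 : (R : ℝ) / (5 * a) < t := by
      refine (Nat.lt_floor_add_one _).trans_le ?_
      exact_mod_cast ht
    rw [div_lt_iff₀ (by positivity)] at h1
    linarith
  refine le_trans ?_ (add_le_add_right (nb_tail ha ha4 hT) _)
  set μ := nb R (expNeg a) (expNeg_lt_one ha) with hμ
  set A := ENNReal.ofReal (Real.exp (9 * a * c)) with hA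
  have key : ∀ t, μ t * f t ≤
      (if c ≤ t then A * (μ (t - c) * f t) else 0) + (if t < T then μ t else 0) := by
    intro t
    by_cases ht : t < T
    · rw [if_pos ht]
      exact le_add_left (mul_le_of_le_one_right' (hf t))
    · have h2 := hT' t (not_lt.1 ht)
      have hct : c ≤ t := by
        have : a * c ≤ a * t := by linarith
        exact_mod_cast le_of_mul_le_mul_left this ha
      obtain ⟨s, rfl⟩ := Nat.exists_eq_add_of_le' hct
      rw [if_pos hct, if_neg ht, add_zero, ← mul_assoc, Nat.add_sub_cancel]
      gcongr
      simp only [hμ, nb_apply, ← mul_assoc]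
      gcongr
      -- From `t = s + c` with `a * t ≥ R / 5`, `a * c ≤ 1` and `R ≥ 10` follows `a * s ≥ R / 5 - 1
      -- ≥ R / 10`.
      refine nbWeight_add_le s c ?_ ha
      push_cast at h2
      linarith
  refine (ENNReal.tsum_le_tsum key).trans ?_
  rw [ENNReal.tsum_add, tsum_ite_le_sub c fun s t => A * (μ s * f t), ENNReal.tsum_mul_left]
  exact le_rfl

/-! ### Random multiples of a fixed element -/

section AtomNoise

variable {α : Type*} [AddCommMonoid α]

/-- The law of `z • g`, where `z` is negative binomial with parameters `r` and `exp (-a)`. -/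
def atomNoise (r : ℝ≥0) {a : ℝ} (ha : 0 < a) (g : α) : PMF α :=
  (nb r (expNeg a) (expNeg_lt_one ha)).map fun k => k • g

theorem atomNoise_eq_mapHom (r : ℝ≥0) {a : ℝ} (ha : 0 < a) (g : α) :
    atomNoise r ha g = mapHom (multiplesHom α g) (nb r (expNeg a) (expNeg_lt_one ha)) := rfl

theorem atomNoise_pow (r : ℝ≥0) {a : ℝ} (ha : 0 < a) (g : α) (n : ℕ) :
    atomNoise r ha g ^ n = atomNoise (n * r) ha g := by
  rw [atomNoise_eq_mapHom, ← map_pow, nb_pow, atomNoise_eq_mapHom]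

theorem mapHom_atomNoise {β : Type*} [AddCommMonoid β] (φ : α →+ β) (r : ℝ≥0) {a : ℝ} (ha : 0 < a)
    (g : α) : mapHom φ (atomNoise r ha g) = atomNoise r ha (φ g) := by
  simp only [mapHom_apply, atomNoise, PMF.map_comp]
  congr 1
  funext k
  simp

theorem atomNoise_zero (r : ℝ≥0) {a : ℝ} (ha : 0 < a) : atomNoise r ha (0 : α) = 1 := by
  refine pmf_ext_expect fun f => ?_
  simp only [atomNoise, expect_map, smul_zero, expect_const, pmf_one_def, expect_pure]

theorem pure_smul_mul_atomNoise (c : ℕ) (r : ℝ≥0) {a : ℝ} (ha : 0 < a) (g : α) :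
    PMF.pure (c • g) * atomNoise r ha g =
      mapHom (multiplesHom α g) (PMF.pure c * nb r (expNeg a) (expNeg_lt_one ha)) := by
  rw [map_mul, ← atomNoise_eq_mapHom, mapHom_apply, PMF.pure_map]
  rfl

theorem indist_pure_mul_atomNoise {r : ℝ≥0} (hr : 1 ≤ r) {a : ℝ} (ha : 0 < a) (c : ℕ) (g : α) :
    Indist (PMF.pure (c • g) * atomNoise r ha g) (atomNoise r ha g)
      (ENNReal.ofReal (Real.exp (a * c))) 0 := by
  rw [pure_smul_mul_atomNoise, atomNoise_eq_mapHom]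
  exact (indist_pure_mul_nb hr ha c).map _

theorem indist_atomNoise_pure_mul {R c : ℕ} {a : ℝ} (ha : 0 < a) (ha4 : a ≤ 1 / 4) (hR : 10 ≤ R)
    (hc : a * c ≤ 1) (g : α) :
    Indist (atomNoise R ha g) (PMF.pure (c • g) * atomNoise R ha g)
      (ENNReal.ofReal (Real.exp (9 * a * c))) (ENNReal.ofReal (Real.exp (-(R / 4)))) := by
  rw [pure_smul_mul_atomNoise, atomNoise_eq_mapHom]
  exact (indist_nb_pure_mul ha ha4 hR hc).map _

theorem prod_pure_mul {ι : Type*} (s : Finset ι) (g : ι → α) (μ : ι → PMF α) :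
    ∏ i ∈ s, PMF.pure (g i) * μ i = PMF.pure (∑ i ∈ s, g i) * ∏ i ∈ s, μ i := by
  classical
  rw [Finset.prod_mul_distrib]
  congr 1
  induction s using Finset.induction_on with
  | empty => rfl
  | insert i s hi ih => rw [Finset.prod_insert hi, Finset.sum_insert hi, ih, pure_mul_pure]

end AtomNoise

/-! ### Flooding noise on a family of atoms -/

section Flood

variable {α ι : Type*} [AddCommMonoid α]

theorem div_natCast_pos {a : ℝ} (ha : 0 < a) {k : ℕ} (hk : 0 < k) : 0 < a / k :=
  div_pos ha (Nat.cast_pos.2 hk)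

/-- Independent negative binomial numbers of copies of the atoms `g i`. The parameter of the noise
on the atom `g i` allows to hide `κ i` copies of this atom. -/
def flood (s : Finset ι) (g : ι → α) (κ : ι → ℕ) (hκ : ∀ i, 0 < κ i) {a : ℝ} (ha : 0 < a)
    (r : ℝ≥0) : PMF α :=
  ∏ i ∈ s, atomNoise r (div_natCast_pos ha (hκ i)) (g i)

variable {s U : Finset ι} {g : ι → α} {κ c : ι → ℕ} {hκ : ∀ i, 0 < κ i} {a : ℝ}

theorem flood_pow (ha : 0 < a) (r : ℝ≥0) (n : ℕ) :
    flood s g κ hκ ha r ^ n = flood s g κ hκ ha (n * r) := by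
  simp only [flood, ← Finset.prod_pow, atomNoise_pow]

theorem div_mul_le_of_le (ha : 0 < a) {k c : ℕ} (hk : 0 < k) (hc : c ≤ k) : a / k * c ≤ a := by
  have hk' : (0 : ℝ) < k := Nat.cast_pos.2 hk
  have hc' : (c : ℝ) ≤ k := Nat.cast_le.2 hc
  calc a / k * c ≤ a / k * k := by gcongr
    _ = a := div_mul_cancel₀ _ hk'.ne'

/-- Atoms outside `U` form a common factor, so the cost of a shift depends on the number of atoms it
involves and not on the size of the family. -/
theorem flood_eq_mul [DecidableEq ι] (hU : U ⊆ s) (ha : 0 < a) (r : ℝ≥0) :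
    flood s g κ hκ ha r = flood (s \ U) g κ hκ ha r * flood U g κ hκ ha r :=
  (Finset.prod_sdiff hU).symm

theorem indist_pure_mul_flood (ha : 0 < a) {r : ℝ≥0} (hr : 1 ≤ r) (hU : U ⊆ s)
    (hc : ∀ i, c i ≤ κ i) :
    Indist (PMF.pure (∑ i ∈ U, c i • g i) * flood s g κ hκ ha r) (flood s g κ hκ ha r)
      (ENNReal.ofReal (Real.exp (a * U.card))) 0 := by
  classical
  rw [flood_eq_mul hU, mul_left_comm]
  refine Indist.mul_left ?_ _
  rw [flood, ← prod_pure_mul]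
  have hA : 1 ≤ ENNReal.ofReal (Real.exp a) := by
    rw [ENNReal.one_le_ofReal]; exact Real.one_le_exp ha.le
  refine (Indist.prod U (A := ENNReal.ofReal (Real.exp a)) (d := 0) hA fun i _ =>
    (indist_pure_mul_atomNoise hr _ (c i) (g i)).mono ?_ le_rfl).mono (le_of_eq ?_) (by simp)
  · gcongr
    exact div_mul_le_of_le ha (hκ i) (hc i)
  · rw [← ENNReal.ofReal_pow (Real.exp_pos _).le, ← Real.exp_nat_mul, mul_comm]

theorem indist_flood_pure_mul (ha : 0 < a) (ha4 : a ≤ 1 / 4) {R : ℕ} (hR : 10 ≤ R) (hU : U ⊆ s)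
    (hc : ∀ i, c i ≤ κ i) :
    Indist (flood s g κ hκ ha R) (PMF.pure (∑ i ∈ U, c i • g i) * flood s g κ hκ ha R)
      (ENNReal.ofReal (Real.exp (9 * a * U.card)))
      (ENNReal.ofReal (U.card * Real.exp (9 * a * U.card) * Real.exp (-(R / 4)))) := by
  classical
  rw [flood_eq_mul hU, mul_left_comm]
  refine Indist.mul_left ?_ _
  rw [flood, ← prod_pure_mul]
  have hA : 1 ≤ ENNReal.ofReal (Real.exp (9 * a)) := by
    rw [ENNReal.one_le_ofReal]; exact Real.one_le_exp (by positivity)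
  have hAU : ENNReal.ofReal (Real.exp (9 * a)) ^ U.card =
      ENNReal.ofReal (Real.exp (9 * a * U.card)) := by
    rw [← ENNReal.ofReal_pow (Real.exp_pos _).le, ← Real.exp_nat_mul, mul_comm]
  refine (Indist.prod U (A := ENNReal.ofReal (Real.exp (9 * a)))
    (d := ENNReal.ofReal (Real.exp (-(R / 4)))) hA fun i _ =>
    (indist_atomNoise_pure_mul (c := c i) _ ?_ hR ?_ (g i)).mono ?_ le_rfl).mono hAU.le
    (le_of_eq ?_)
  · refine le_trans ?_ ha4
    exact div_le_self ha.le (Nat.one_le_cast.2 (hκ i))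
  · exact (div_mul_le_of_le ha (hκ i) (hc i)).trans (by linarith)
  · rw [mul_assoc]
    gcongr
    exact div_mul_le_of_le ha (hκ i) (hc i)
  · rw [hAU, ENNReal.ofReal_mul (by positivity), ENNReal.ofReal_mul (by positivity),
      ENNReal.ofReal_natCast]

end Flood

/-! ### Zero-sum atoms and the identity relating two inputs -/

section Atoms

variable {M : Type*} (msg : ℤ → M)

/-- The message `x` together with the negated powers of two in its binary expansion. -/
def digitAtom (m x : ℕ) : Multiset M :=
  {msg x} + ∑ j ∈ Finset.range (m + 1), (x / 2 ^ j % 2) • {msg (-2 ^ j)}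

/-- A power of two and its negation. -/
def pairAtom (j : ℕ) : Multiset M := {msg (2 ^ j)} + {msg (-2 ^ j)}

/-- A negated power of two together with its two halves. -/
def splitAtom (j : ℕ) : Multiset M := {msg (-2 ^ (j + 1))} + 2 • {msg (2 ^ j)}

theorem sum_div_two_pow_smul {α : Type*} [AddCommMonoid α] (u : ℕ → α) {m x : ℕ}
    (hx : x < 2 ^ m) :
    ∑ j ∈ Finset.range m, (x / 2 ^ j) • u j =
      x • u 0 + ∑ j ∈ Finset.range m, (x / 2 ^ (j + 1)) • u (j + 1) := by
  have h1 := Finset.sum_range_succ (fun j => (x / 2 ^ j) • u j) m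
  have h2 := Finset.sum_range_succ' (fun j => (x / 2 ^ j) • u j) m
  rw [Nat.div_eq_of_lt hx, zero_smul, add_zero] at h1
  rw [← h1, h2, add_comm, pow_zero, Nat.div_one]

/-- Trading `x` copies of `-1` for the binary digits of `x` is repeated carrying: each split atom,
corrected by two pair atoms, replaces two copies of `-2 ^ j` by one of `-2 ^ (j + 1)`. Carrying
keeps the number of atom types logarithmic in the range. Since inputs reach `2 ^ m`, there are `m +
1` digits. -/
theorem atom_identity {m x : ℕ} (hx : x < 2 ^ (m + 1)) :
    {msg x} + x • {msg (-1)} + ∑ j ∈ Finset.range (m + 1), (x / 2 ^ (j + 1)) • splitAtom msg j =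
      digitAtom msg m x +
        ∑ j ∈ Finset.range (m + 1), (2 * (x / 2 ^ (j + 1))) • pairAtom msg j := by
  have h := sum_div_two_pow_smul (fun j => ({msg (-2 ^ j)} : Multiset M)) hx
  have h2 : ∀ j, (x / 2 ^ j) = x / 2 ^ j % 2 + 2 * (x / 2 ^ (j + 1)) := fun j => by
    rw [pow_succ, ← Nat.div_div_eq_div_mul, Nat.mod_add_div]
  simp only [digitAtom, splitAtom, pairAtom, smul_add, Finset.sum_add_distrib]
  rw [Finset.sum_congr rfl fun j _ => by rw [h2 j, add_smul], Finset.sum_add_distrib,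
    pow_zero] at h
  have h3 : ∀ j, (x / 2 ^ (j + 1)) • 2 • ({msg (2 ^ j)} : Multiset M) =
      (2 * (x / 2 ^ (j + 1))) • {msg (2 ^ j)} := fun j => by rw [smul_smul, mul_comm]
  simp only [h3]
  calc _ = {msg x} + (x • {msg (-1)} +
        ∑ j ∈ Finset.range (m + 1), (x / 2 ^ (j + 1)) • ({msg (-2 ^ (j + 1))} : Multiset M)) +
        ∑ j ∈ Finset.range (m + 1), (2 * (x / 2 ^ (j + 1))) • ({msg (2 ^ j)} : Multiset M) := by
        abel
    _ = _ := by rw [← h]; abel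

/-- The index set of the atoms: a digit atom for every value of an input, and the pair and split
atoms for every power of two. -/
def atomIndex (m : ℕ) : Finset (ℕ ⊕ ℕ ⊕ ℕ) :=
  (Finset.range (2 ^ m + 1)).disjSum ((Finset.range (m + 1)).disjSum (Finset.range (m + 1)))

/-- The atom with a given index. -/
def atom (m : ℕ) : ℕ ⊕ ℕ ⊕ ℕ → Multiset M :=
  Sum.elim (digitAtom msg m) (Sum.elim (pairAtom msg) (splitAtom msg))

/-- The number of copies of the atom with a given index that have to be hidden. -/
def atomCap (m : ℕ) : ℕ ⊕ ℕ ⊕ ℕ → ℕ :=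
  Sum.elim (fun _ => 1) (Sum.elim (fun j => 2 * 2 ^ (m - j)) fun j => 2 * 2 ^ (m - j))

theorem atomCap_pos (m : ℕ) (i : ℕ ⊕ ℕ ⊕ ℕ) : 0 < atomCap m i := by
  rcases i with x | j | j <;> simp [atomCap]

/-- The atoms used to hide one input. -/
def activeIndex (m x : ℕ) : Finset (ℕ ⊕ ℕ ⊕ ℕ) :=
  ({x} : Finset ℕ).disjSum ((Finset.range (m + 1)).disjSum (Finset.range (m + 1)))

theorem card_activeIndex (m x : ℕ) : (activeIndex m x).card = 2 * m + 3 := by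
  simp [activeIndex, Finset.card_disjSum]
  ring

theorem activeIndex_subset {m x : ℕ} (hx : x ≤ 2 ^ m) : activeIndex m x ⊆ atomIndex m :=
  Finset.disjSum_mono (by simpa using Nat.lt_succ_of_le hx) subset_rfl

/-- The numbers of copies of the atoms that relate the inputs `x` and `y`. -/
def hidingCoeff (x y t : ℕ) : ℕ ⊕ ℕ ⊕ ℕ → ℕ :=
  Sum.elim (fun _ => 1) (Sum.elim (fun j => 2 * (y / 2 ^ (j + 1)) + if j = 0 then t else 0)
    fun j => x / 2 ^ (j + 1))

theorem div_two_pow_le {m x : ℕ} (hx : x ≤ 2 ^ m) (j : ℕ) : x / 2 ^ j ≤ 2 ^ (m - j) := by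
  refine Nat.div_le_of_le_mul (hx.trans ?_)
  rw [← pow_add]
  exact Nat.pow_le_pow_right two_pos (by omega)

theorem hidingCoeff_le {m x y t : ℕ} (hx : x ≤ 2 ^ m) (hy : y ≤ 2 ^ m) (ht : t ≤ 2 ^ m)
    (i : ℕ ⊕ ℕ ⊕ ℕ) : hidingCoeff x y t i ≤ atomCap m i := by
  have key : ∀ z, z ≤ 2 ^ m → ∀ j, 2 * (z / 2 ^ (j + 1)) ≤ 2 ^ (m - j) := fun z hz j => by
    rw [pow_succ, ← Nat.div_div_eq_div_mul]
    exact (Nat.mul_div_le _ _).trans (div_two_pow_le hz j)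
  rcases i with z | j | j
  · simp [hidingCoeff, atomCap]
  · simp only [hidingCoeff, atomCap, Sum.elim_inr, Sum.elim_inl]
    have h := key y hy j
    split_ifs with hj
    · subst hj
      simp only [Nat.sub_zero] at h ⊢
      omega
    · omega
  · simp only [hidingCoeff, atomCap, Sum.elim_inr]
    have h := key x hx j
    omega

theorem sum_hidingCoeff (m x y z t : ℕ) :
    ∑ i ∈ activeIndex m z, hidingCoeff x y t i • atom msg m i =
      digitAtom msg m z + (∑ j ∈ Finset.range (m + 1), (2 * (y / 2 ^ (j + 1))) • pairAtom msg j +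
        t • pairAtom msg 0) + ∑ j ∈ Finset.range (m + 1), (x / 2 ^ (j + 1)) • splitAtom msg j := by
  simp only [activeIndex, Finset.sum_disjSum, hidingCoeff, atom, Sum.elim_inl, Sum.elim_inr,
    Finset.sum_singleton, one_smul, add_smul, Finset.sum_add_distrib, ite_smul, zero_smul]
  rw [Finset.sum_ite_eq' (Finset.range (m + 1)) 0 fun j => t • pairAtom msg j,
    if_pos (Finset.mem_range.2 m.succ_pos)]
  abel

/-- `atom_identity` for `x` and, reversed, for `y` exchanges the inputs, leaving `x` copies of `1`
and `y` copies of `-1`. Cancelling `min x y` zero-sum pairs leaves only the signed difference. -/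
theorem hiding_identity {m x y : ℕ} (hx : x ≤ 2 ^ m) (hy : y ≤ 2 ^ m) :
    {msg x} + ∑ i ∈ activeIndex m y, hidingCoeff x y x i • atom msg m i =
      {msg y} + ∑ i ∈ activeIndex m x, hidingCoeff y x (min x y) i • atom msg m i +
        ((x - y) • {msg 1} + (y - x) • {msg (-1)}) := by
  have hlt : 2 ^ m < 2 ^ (m + 1) := Nat.pow_lt_pow_right one_lt_two m.lt_succ_self
  have h1 := atom_identity msg (hx.trans_lt hlt)
  have h2 := atom_identity msg (hy.trans_lt hlt)
  rw [sum_hidingCoeff, sum_hidingCoeff]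
  set Sx := ∑ j ∈ Finset.range (m + 1), (x / 2 ^ (j + 1)) • splitAtom msg j
  set Sy := ∑ j ∈ Finset.range (m + 1), (y / 2 ^ (j + 1)) • splitAtom msg j
  set Px := ∑ j ∈ Finset.range (m + 1), (2 * (x / 2 ^ (j + 1))) • pairAtom msg j
  set Py := ∑ j ∈ Finset.range (m + 1), (2 * (y / 2 ^ (j + 1))) • pairAtom msg j
  have hp : pairAtom msg 0 = {msg 1} + {msg (-1)} := by simp [pairAtom]
  have h3 : x • ({msg 1} : Multiset M) + y • {msg (-1)} =
      min x y • pairAtom msg 0 + ((x - y) • {msg 1} + (y - x) • {msg (-1)}) := by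
    rw [hp]
    rcases le_total x y with h | h
    · obtain ⟨d, rfl⟩ := Nat.exists_eq_add_of_le h
      simp only [le_add_iff_nonneg_right, zero_le, min_eq_left, smul_add, add_smul, Nat.sub_self_add,
        zero_smul, zero_add, add_tsub_cancel_left]
      abel
    · obtain ⟨d, rfl⟩ := Nat.exists_eq_add_of_le h
      simp only [le_add_iff_nonneg_right, zero_le, min_eq_right, smul_add, add_smul,
        Nat.sub_self_add, zero_smul, add_zero, add_tsub_cancel_left]
      abel
  have hL : {msg x} + (digitAtom msg m y + (Py + x • pairAtom msg 0) + Sx) =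
      ({msg x} + x • {msg (-1)} + Sx) + (digitAtom msg m y + Py) + x • {msg 1} := by
    rw [hp, smul_add]; abel
  rw [hL, h1, ← h2]
  calc _ = {msg y} + Sy + digitAtom msg m x + Px +
        (x • ({msg 1} : Multiset M) + y • {msg (-1)}) := by abel
    _ = _ := by rw [h3]; abel

end Atoms

/-! ### Privacy of one rounded input under the total noise -/

section Noise

variable {M : Type*} (msg : ℤ → M) {a b : ℝ}

/-- The noise of all users together if `c = 1`, and the noise of one of `n` users if `c = 1 / n`:
the flooding noise on the zero-sum atoms and the two central geometric noises. -/
def totalNoise (m : ℕ) (ha : 0 < a) (hb : 0 < b) (R : ℕ) (c : ℝ≥0) : PMF (Multiset M) :=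
  flood (atomIndex m) (atom msg m) (atomCap m) (atomCap_pos m) ha (c * R) *
    (atomNoise c hb {msg 1} * atomNoise c hb {msg (-1)})

theorem totalNoise_pow (m : ℕ) (ha : 0 < a) (hb : 0 < b) (R : ℕ) (c : ℝ≥0) (n : ℕ) :
    totalNoise msg m ha hb R c ^ n = totalNoise msg m ha hb R (n * c) := by
  simp only [totalNoise, mul_pow, flood_pow, atomNoise_pow, mul_assoc]

theorem indist_central {m x y : ℕ} (hx : x ≤ 2 ^ m) (hy : y ≤ 2 ^ m) (hb : 0 < b) :
    Indist (PMF.pure ((x - y) • ({msg 1} : Multiset M) + (y - x) • {msg (-1)}) *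
        (atomNoise 1 hb {msg 1} * atomNoise 1 hb {msg (-1)}))
      (atomNoise 1 hb {msg 1} * atomNoise 1 hb {msg (-1)})
      (ENNReal.ofReal (Real.exp (b * 2 ^ m))) 0 := by
  have hle : ∀ d : ℕ, d ≤ 2 ^ m →
      ENNReal.ofReal (Real.exp (b * d)) ≤ ENNReal.ofReal (Real.exp (b * 2 ^ m)) := fun d hd => by
    gcongr
    exact_mod_cast hd
  rcases le_total x y with h | h
  · rw [Nat.sub_eq_zero_of_le h, zero_smul, zero_add, mul_left_comm]
    exact ((indist_pure_mul_atomNoise le_rfl hb (y - x) {msg (-1)}).mul_left _).mono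
      (hle _ (by omega)) le_rfl
  · rw [Nat.sub_eq_zero_of_le h, zero_smul, add_zero, ← mul_assoc]
    exact ((indist_pure_mul_atomNoise le_rfl hb (x - y) {msg 1}).mul_right _).mono
      (hle _ (by omega)) le_rfl

theorem indist_input {m x y : ℕ} (hx : x ≤ 2 ^ m) (hy : y ≤ 2 ^ m) (ha : 0 < a) (ha4 : a ≤ 1 / 4)
    (hb : 0 < b) {R : ℕ} (hR : 10 ≤ R) :
    Indist (PMF.pure {msg x} * totalNoise msg m ha hb R 1)
      (PMF.pure {msg y} * totalNoise msg m ha hb R 1)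
      (ENNReal.ofReal (Real.exp (9 * a * (4 * m + 6) + b * 2 ^ m)))
      (ENNReal.ofReal
        ((2 * m + 3) * Real.exp (9 * a * (2 * m + 3)) * Real.exp (-(R / 4)))) := by
  simp only [totalNoise, one_mul]
  set F := flood (atomIndex m) (atom msg m) (atomCap m) (atomCap_pos m) ha R with hF
  set Z := atomNoise 1 hb ({msg 1} : Multiset M) * atomNoise 1 hb {msg (-1)} with hZ
  set GA := ∑ i ∈ activeIndex m y, hidingCoeff x y x i • atom msg m i with hGA
  set GB := ∑ i ∈ activeIndex m x, hidingCoeff y x (min x y) i • atom msg m i with hGB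
  set D : Multiset M := (x - y) • {msg 1} + (y - x) • {msg (-1)} with hD
  have h1 : Indist F (PMF.pure GA * F) (ENNReal.ofReal (Real.exp (9 * a * (2 * m + 3))))
      (ENNReal.ofReal
        ((2 * m + 3) * Real.exp (9 * a * (2 * m + 3)) * Real.exp (-(R / 4)))) := by
    have h := indist_flood_pure_mul (g := atom msg m) (hκ := atomCap_pos m) ha ha4 hR
      (activeIndex_subset hy) (hidingCoeff_le hx hy hx)
    rw [card_activeIndex] at h
    push_cast at h
    exact h
  have h2 : Indist (PMF.pure GB * F) F (ENNReal.ofReal (Real.exp (a * (2 * m + 3)))) 0 := by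
    have hR1 : (1 : ℝ≥0) ≤ R := by exact_mod_cast le_trans (by norm_num) hR
    have h := indist_pure_mul_flood (g := atom msg m) (hκ := atomCap_pos m) ha hR1
      (activeIndex_subset hx) (hidingCoeff_le hy hx ((min_le_left x y).trans hx))
    rw [card_activeIndex] at h
    push_cast at h
    exact h
  have h3 : Indist (PMF.pure D * Z) Z (ENNReal.ofReal (Real.exp (b * 2 ^ m))) 0 :=
    indist_central msg hx hy hb
  have e : PMF.pure {msg x} * (PMF.pure GA * F * Z) =
      PMF.pure {msg y} * (PMF.pure GB * F * (PMF.pure D * Z)) := by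
    calc _ = PMF.pure ({msg x} + GA) * (F * Z) := by
          rw [← pure_mul_pure, mul_assoc, mul_assoc]
      _ = PMF.pure ({msg y} + GB + D) * (F * Z) := by rw [hiding_identity msg hx hy]
      _ = _ := by
          rw [← pure_mul_pure, ← pure_mul_pure]
          simp only [mul_assoc, mul_left_comm F]
  have s1 := (h1.mul_right Z).mul_left (PMF.pure {msg x})
  rw [e] at s1
  have s2 := (h2.mul_right (PMF.pure D * Z)).mul_left (PMF.pure {msg y})
  have s3 := (h3.mul_left F).mul_left (PMF.pure {msg y})
  refine (s1.trans (s2.trans s3)).mono ?_ (by simp)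
  rw [← ENNReal.ofReal_mul (Real.exp_pos _).le, ← ENNReal.ofReal_mul (Real.exp_pos _).le,
    ← Real.exp_add, ← Real.exp_add]
  refine ENNReal.ofReal_le_ofReal (Real.exp_le_exp.2 ?_)
  -- Inserting `GA` costs `9 * a * (2 * m + 3)` and absorbing `GB` costs `a * (2 * m + 3)`; together
  -- they are below the rounder `9 * a * (4 * m + 6)`.
  have hm : 0 ≤ a * (2 * m + 3) := by positivity
  linarith

end Noise

/-! ### Randomized rounding -/

section Rounding

/-- Unbiased randomized rounding of `y ≥ 0` to one of the two nearest integers. -/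
def roundLaw (y : ℝ) : PMF ℕ :=
  (PMF.ofFintype
    (fun c : Bool => cond c (ENNReal.ofReal (Int.fract y)) (ENNReal.ofReal (1 - Int.fract y))) (by
      rw [Fintype.sum_bool, cond_true, cond_false, ← ENNReal.ofReal_add (Int.fract_nonneg y)
        (sub_nonneg.2 (Int.fract_lt_one y).le), add_sub_cancel, ENNReal.ofReal_one])).map
    fun c => cond c ⌈y⌉₊ ⌊y⌋₊

theorem expect_roundLaw (y : ℝ) (f : ℕ → ℝ≥0∞) :
    expect (roundLaw y) f =
      ENNReal.ofReal (Int.fract y) * f ⌈y⌉₊ + ENNReal.ofReal (1 - Int.fract y) * f ⌊y⌋₊ := by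
  rw [roundLaw, expect_map, expect, tsum_fintype, Fintype.sum_bool]
  simp only [PMF.ofFintype_apply, cond_true, cond_false]

theorem le_of_mem_support_roundLaw {y : ℝ} {N k : ℕ} (hy : y ≤ N)
    (hk : k ∈ (roundLaw y).support) : k ≤ N := by
  rw [roundLaw, PMF.mem_support_map_iff] at hk
  obtain ⟨c, -, rfl⟩ := hk
  have h := Nat.ceil_le.2 hy
  cases c
  · exact (Nat.floor_le_ceil y).trans h
  · exact h

end Rounding

/-! ### The protocol and its privacy -/

section SumProtocol

variable {M : Type*} (msg : ℤ → M) (dec : M → ℤ) {a b : ℝ}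

/-- The protocol for real summation: every user sends their randomly rounded input together with
their share of the noise, and the analyzer adds up all messages. -/
def sumProtocol (m : ℕ) (ha : 0 < a) (hb : 0 < b) (R n : ℕ) :
    Protocol (Set.Icc (0 : ℝ) 1) M where
  randomizer x := (roundLaw (x * 2 ^ m)).map (fun k : ℕ => {msg k}) *
    totalNoise msg m ha hb R (n : ℝ≥0)⁻¹
  analyzer l := ((l.map dec).sum : ℤ) / 2 ^ m

theorem collect_sumProtocol (m : ℕ) (ha : 0 < a) (hb : 0 < b) (R : ℕ) {n : ℕ} (hn : n ≠ 0)
    (x : Fin n → Set.Icc (0 : ℝ) 1) :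
    collect (sumProtocol msg dec m ha hb R n).randomizer n x =
      (∏ i, (roundLaw (x i * 2 ^ m)).map fun k : ℕ => ({msg k} : Multiset M)) *
        totalNoise msg m ha hb R 1 := by
  rw [collect_eq_prod]
  simp only [sumProtocol, Finset.prod_mul_distrib, Finset.prod_const, Finset.card_univ,
    Fintype.card_fin, totalNoise_pow]
  rw [mul_inv_cancel₀ (Nat.cast_ne_zero.2 hn)]

theorem indist_roundLaw_mul {α : Type*} [AddCommMonoid α] {N : ℕ} {u v : ℝ} (hu : u ≤ N)
    (hv : v ≤ N) (ν : PMF α) (F : ℕ → α) {A d : ℝ≥0∞}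
    (h : ∀ k ≤ N, ∀ l ≤ N, Indist (PMF.pure (F k) * ν) (PMF.pure (F l) * ν) A d) :
    Indist ((roundLaw u).map F * ν) ((roundLaw v).map F * ν) A d := by
  -- Truncation at `N` changes nothing on the support, and makes the comparison available for all
  -- pairs of indices, as `Indist.bind_left` requires.
  have e : ∀ w : ℝ, w ≤ N →
      (roundLaw w).map F * ν = (roundLaw w).bind fun k => PMF.pure (F (min k N)) * ν := by
    intro w hw
    refine pmf_ext_expect fun f => ?_
    rw [expect_mul, expect_map, expect_bind]
    refine tsum_congr fun k => ?_
    by_cases hk : roundLaw w k = 0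
    · rw [hk, zero_mul, zero_mul]
    · beta_reduce
      rw [min_eq_left (le_of_mem_support_roundLaw hw hk), expect_mul, expect_pure]
  rw [e u hu, e v hv]
  exact Indist.bind_left _ _ fun k l => h _ (min_le_right k N) _ (min_le_right l N)

theorem isShuffleDP_sumProtocol {m : ℕ} (ha : 0 < a) (ha4 : a ≤ 1 / 4) (hb : 0 < b) {R : ℕ}
    (hR : 10 ≤ R) {n : ℕ} (hn : n ≠ 0) {ε δ : ℝ}
    (hε : 9 * a * (4 * m + 6) + b * 2 ^ m ≤ ε)
    (hδ : (2 * m + 3) * Real.exp (9 * a * (2 * m + 3)) * Real.exp (-(R / 4)) ≤ δ) :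
    (sumProtocol msg dec m ha hb R n).IsShuffleDP n ε δ := by
  rintro x x' ⟨i, hi⟩ S
  refine Indist.toOuterMeasure_le (Indist.bind ?_ shuffle) S
  rw [collect_sumProtocol msg dec m ha hb R hn, collect_sumProtocol msg dec m ha hb R hn,
    ← Finset.mul_prod_erase _ _ (Finset.mem_univ i),
    ← Finset.mul_prod_erase (a := i) _ (fun j => (roundLaw (x' j * 2 ^ m)).map _)
      (Finset.mem_univ i),
    Finset.prod_congr rfl fun j hj => by rw [hi j (Finset.ne_of_mem_erase hj)],
    mul_right_comm, mul_right_comm (PMF.map _ (roundLaw (x' i * 2 ^ m)))]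
  refine Indist.mul_right ?_ _
  have hle : ∀ z : Set.Icc (0 : ℝ) 1, (z : ℝ) * 2 ^ m ≤ ((2 ^ m : ℕ) : ℝ) := fun z => by
    push_cast
    exact mul_le_of_le_one_left (by positivity) z.2.2
  refine indist_roundLaw_mul (hle _) (hle _) _ _ fun k hk l hl =>
    (indist_input msg hk hl ha ha4 hb hR).mono ?_ ?_
  · gcongr
  · gcongr

end SumProtocol

/-! ### Moments of the geometric law -/

theorem geomMean_expNeg {a : ℝ} (ha : 0 < a) :
    geomMean (expNeg a) = ENNReal.ofReal (1 / (Real.exp a - 1)) := by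
  have hp := expNeg_lt_one ha
  have h1 : (1 - expNeg a : ℝ≥0) ≠ 0 := (tsub_pos_of_lt hp).ne'
  have hexp : 1 < Real.exp a := Real.one_lt_exp_iff.2 ha
  rw [geomMean, ← ENNReal.coe_one, ← ENNReal.coe_sub, ← ENNReal.coe_inv h1, ← ENNReal.coe_mul,
    ← ENNReal.ofReal_coe_nnreal, NNReal.coe_mul, NNReal.coe_inv, NNReal.coe_sub hp.le, coe_expNeg,
    NNReal.coe_one, Real.exp_neg]
  congr 1
  have : Real.exp a - 1 ≠ 0 := by linarith
  field_simp

theorem geomMean_expNeg_le {a : ℝ} (ha : 0 < a) :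
    geomMean (expNeg a) ≤ ENNReal.ofReal (1 / a) := by
  rw [geomMean_expNeg ha]
  gcongr
  linarith [Real.add_one_le_exp a]

/-- The left side, the variance of discrete Laplace noise, equals `1 / (2 * sinh (a / 2) ^ 2)`, and
`sinh (a / 2) ≥ a / 2`. Thus discretizing the noise costs no accuracy. -/
theorem geom_variance_le {a : ℝ} (ha : 0 < a) :
    2 * (1 / (Real.exp a - 1)) ^ 2 + 2 * (1 / (Real.exp a - 1)) ≤ 2 / a ^ 2 := by
  have hs : a / 2 ≤ Real.sinh (a / 2) := Real.self_le_sinh_iff.2 (by positivity)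
  rw [Real.sinh_eq] at hs
  set u := Real.exp (a / 2) with hu
  have hu0 : 0 < u := Real.exp_pos _
  have hun : Real.exp (-(a / 2)) = 1 / u := by rw [Real.exp_neg, one_div]
  have hua : Real.exp a = u ^ 2 := by rw [hu, ← Real.exp_nat_mul]; congr 1; push_cast; ring
  rw [hun] at hs
  have h1 : a * u ≤ u ^ 2 - 1 := by
    have : a ≤ u - 1 / u := by linarith
    calc a * u ≤ (u - 1 / u) * u := by gcongr
      _ = u ^ 2 - 1 := by field_simp
  have h2 : 0 < u ^ 2 - 1 := lt_of_lt_of_le (by positivity) h1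
  rw [hua]
  have e : 2 * (1 / (u ^ 2 - 1)) ^ 2 + 2 * (1 / (u ^ 2 - 1)) = 2 * u ^ 2 / (u ^ 2 - 1) ^ 2 := by
    field_simp
    ring
  rw [e, div_le_div_iff₀ (by positivity) (by positivity)]
  have h3 : (a * u) ^ 2 ≤ (u ^ 2 - 1) ^ 2 := by gcongr
  nlinarith

/-! ### Mean squared errors of rounding, central noise and the Laplace mechanism -/

section MeanSquaredError

/-- Mean squared deviation of an integer-valued law from a real number. -/
def sqDev (μ : PMF ℤ) (c : ℝ) : ℝ≥0∞ := expect μ fun t => ENNReal.ofReal ((t - c) ^ 2)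

theorem mse_toMeasure (μ : PMF ℝ) (v : ℝ) :
    mse μ.toMeasure v = expect μ fun y => ENNReal.ofReal ((y - v) ^ 2) := by
  have h : μ.toMeasure = MeasureTheory.Measure.sum fun a => μ a • MeasureTheory.Measure.dirac a := by
    ext S hS
    rw [PMF.toMeasure_apply μ hS, MeasureTheory.Measure.sum_apply _ hS]
    refine tsum_congr fun a => ?_
    rw [MeasureTheory.Measure.smul_apply, MeasureTheory.Measure.dirac_apply' _ hS]
    by_cases ha : a ∈ S <;> simp [ha]
  rw [mse, h, MeasureTheory.lintegral_sum_measure]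
  refine tsum_congr fun a => ?_
  rw [MeasureTheory.lintegral_smul_measure, MeasureTheory.lintegral_dirac' _ (by fun_prop),
    smul_eq_mul]

/-- Rounding is unbiased, so the cross term vanishes, and its variance `f * (1 - f)`, with `f` the
fractional part, is at most `1 / 4`. -/
theorem sq_rounding {y : ℝ} (hy : 0 ≤ y) (d : ℝ) :
    Int.fract y * (d + (⌈y⌉₊ - y)) ^ 2 + (1 - Int.fract y) * (d + (⌊y⌋₊ - y)) ^ 2 ≤
      d ^ 2 + 1 / 4 := by
  have hfl : (⌊y⌋₊ : ℝ) = y - Int.fract y := by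
    rw [natCast_floor_eq_intCast_floor hy, ← Int.self_sub_fract]
  rw [hfl]
  by_cases h0 : Int.fract y = 0
  · rw [h0]
    nlinarith
  · have hce : (⌈y⌉₊ : ℝ) = y - Int.fract y + 1 := by
      have h1 : ⌈y⌉ = ⌊y⌋ + 1 := by
        rw [Int.ceil_eq_iff]
        have := Int.floor_add_fract y
        have h2 := (Int.fract_nonneg y).lt_of_ne' h0
        have h3 := Int.fract_lt_one y
        push_cast
        constructor <;> linarith
      rw [natCast_ceil_eq_intCast_ceil hy, h1, Int.self_sub_fract]
      push_cast
      ring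
    rw [hce]
    nlinarith [sq_nonneg (Int.fract y - 1 / 2)]

theorem sqDev_roundLaw_mul_le (μ : PMF ℤ) (c : ℝ) {y : ℝ} (hy : 0 ≤ y) :
    sqDev ((roundLaw y).map (fun k : ℕ => (k : ℤ)) * μ) (c + y) ≤
      sqDev μ c + ENNReal.ofReal (1 / 4) := by
  rw [sqDev, mul_comm, expect_mul, sqDev, ← expect_const μ (ENNReal.ofReal (1 / 4)), ← expect_add]
  refine expect_mono μ fun t => ?_
  have hf := Int.fract_nonneg y
  have hf1 := sub_nonneg.2 (Int.fract_lt_one y).le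
  rw [expect_map, expect_roundLaw, ← ENNReal.ofReal_mul hf, ← ENNReal.ofReal_mul hf1,
    ← ENNReal.ofReal_add (by positivity) (by positivity),
    ← ENNReal.ofReal_add (by positivity) (by positivity)]
  refine ENNReal.ofReal_le_ofReal ((le_of_eq ?_).trans (sq_rounding hy (t - c)))
  push_cast
  ring

theorem sqDev_prod_roundLaw_mul_le {ι : Type*} (s : Finset ι) (μ : PMF ℤ) {y : ι → ℝ}
    (hy : ∀ i, 0 ≤ y i) :
    sqDev ((∏ i ∈ s, (roundLaw (y i)).map fun k : ℕ => (k : ℤ)) * μ) (∑ i ∈ s, y i) ≤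
      sqDev μ 0 + s.card * ENNReal.ofReal (1 / 4) := by
  classical
  induction s using Finset.induction_on with
  | empty => simp
  | insert i s hi ih =>
    rw [Finset.prod_insert hi, Finset.sum_insert hi, Finset.card_insert_of_notMem hi, mul_assoc,
      add_comm (y i)]
    refine (sqDev_roundLaw_mul_le _ _ (hy i)).trans ?_
    push_cast
    rw [add_mul, one_mul, ← add_assoc]
    gcongr

theorem sqDev_central_le {b : ℝ} (hb : 0 < b) :
    sqDev (atomNoise 1 hb (1 : ℤ) * atomNoise 1 hb (-1)) 0 ≤ ENNReal.ofReal (2 / b ^ 2) := by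
  set g := geomMean (expNeg b) with hg
  set μ := nb 1 (expNeg b) (expNeg_lt_one hb) with hμ
  have hgt : g ≠ ∞ := by rw [hg, geomMean_expNeg hb]; exact ENNReal.ofReal_ne_top
  have hmean : expect μ (fun k => (k : ℝ≥0∞)) = g := by rw [hμ, expect_nb_id]; simp [hg]
  have hsq : expect μ (fun k => (k : ℝ≥0∞) * k) = g * (2 * g + 1) := expect_nb_one_sq _
  -- The square is expanded with the mixed term on the left, since extended nonnegative reals do not
  -- allow subtraction; its finite expectation is cancelled at the end.
  have hpt : ∀ u v : ℕ, ENNReal.ofReal (((u : ℝ) - v) ^ 2) + 2 * ((u : ℝ≥0∞) * v) =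
      (u : ℝ≥0∞) * u + v * v := fun u v => by
    simp only [← ENNReal.ofReal_natCast]
    rw [show (2 : ℝ≥0∞) = ENNReal.ofReal 2 by simp]
    rw [← ENNReal.ofReal_mul (by positivity), ← ENNReal.ofReal_mul (by positivity),
      ← ENNReal.ofReal_mul (by positivity), ← ENNReal.ofReal_mul (by positivity),
      ← ENNReal.ofReal_add (by positivity) (by positivity),
      ← ENNReal.ofReal_add (by positivity) (by positivity)]
    congr 1
    ring
  have hsum : sqDev (atomNoise 1 hb (1 : ℤ) * atomNoise 1 hb (-1)) 0 + 2 * (g * g) =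
      (2 * (g * g) + 2 * g) + 2 * (g * g) := by
    have e : sqDev (atomNoise 1 hb (1 : ℤ) * atomNoise 1 hb (-1)) 0 =
        expect μ fun u => expect μ fun v => ENNReal.ofReal (((u : ℝ) - v) ^ 2) := by
      simp only [sqDev, expect_mul, atomNoise, expect_map, ← hμ]
      congr 1
      funext u
      congr 1
      funext v
      congr 2
      simp
      ring
    have e2 : 2 * (g * g) = expect μ fun u => expect μ fun v => 2 * ((u : ℝ≥0∞) * v) := by
      simp only [expect_mul_left, hmean, expect_mul_right]
    conv_lhs => rw [e, e2]
    simp only [← expect_add, hpt]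
    simp only [expect_add, expect_const, hsq]
    ring
  have h2 := (ENNReal.add_left_inj (by finiteness)).1 hsum
  have hexp : 0 < Real.exp b - 1 := by linarith [Real.add_one_le_exp b]
  rw [h2, hg, geomMean_expNeg hb, show (2 : ℝ≥0∞) = ENNReal.ofReal 2 by simp,
    ← ENNReal.ofReal_mul (by positivity), ← ENNReal.ofReal_mul (by positivity),
    ← ENNReal.ofReal_mul (by positivity), ← ENNReal.ofReal_add (by positivity) (by positivity)]
  refine ENNReal.ofReal_le_ofReal ((le_of_eq ?_).trans (geom_variance_le hb))
  ring

/-- The mean squared error of the Laplace mechanism with parameter `a` is at least `2 / a ^ 2`. -/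
theorem le_mse_laplaceMechanism {a : ℝ} (ha : 0 < a) {n : ℕ} (x : Fin n → Set.Icc (0 : ℝ) 1) :
    ENNReal.ofReal (2 / a ^ 2) ≤ mse (laplaceMechanism a x) (realSum x) := by
  have hint : ∫ t in Set.Ioi (0 : ℝ), t ^ 2 * Real.exp (-(a * t)) = 2 / a ^ 3 := by
    have h := Real.integral_rpow_mul_exp_neg_mul_Ioi (a := 3) (r := a) (by norm_num) ha
    norm_num at h
    rw [h, div_eq_inv_mul]
  set F : ℝ → ℝ := fun t => a / 2 * (t ^ 2 * Real.exp (-(a * t))) with hF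
  have hval : ∫ t, F |t| = 2 / a ^ 2 := by
    rw [integral_comp_abs, hF, MeasureTheory.integral_const_mul, hint]
    field_simp
  rw [mse, laplaceMechanism, MeasureTheory.lintegral_map (by fun_prop) (by fun_prop), laplace,
    MeasureTheory.lintegral_withDensity_eq_lintegral_mul _ (by fun_prop) (by fun_prop), ← hval,
    MeasureTheory.integral_eq_lintegral_of_nonneg_ae
      (Filter.Eventually.of_forall fun t => by simp only [hF, Pi.zero_apply]; positivity)
      (by fun_prop)]
  -- Only a lower bound is wanted, so finiteness of the integral need not be shown here.
  refine ENNReal.ofReal_toReal_le.trans (le_of_eq (MeasureTheory.lintegral_congr fun t => ?_))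
  rw [Pi.mul_apply, ← ENNReal.ofReal_mul (by positivity)]
  congr 1
  simp only [hF, sq_abs]
  ring_nf

end MeanSquaredError

/-! ### Accuracy of the protocol -/

section Analysis

variable {M : Type*} (msg : ℤ → M) (dec : M → ℤ) {a b : ℝ}

/-- The sum of the values of the messages of a multiset. -/
def valueSum : Multiset M →+ ℤ := Multiset.sumAddMonoidHom.comp (Multiset.mapAddMonoidHom dec)

theorem valueSum_singleton (v : M) : valueSum dec {v} = dec v := by simp [valueSum]

theorem expect_shuffle_valueSum (s : Multiset M) (f : ℤ → ℝ≥0∞) :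
    expect (shuffle s) (fun l => f (l.map dec).sum) = f (valueSum dec s) := by
  rw [shuffle, expect_map]
  refine (congrArg _ (funext fun σ => ?_)).trans (expect_const _ _)
  congr 1
  rw [List.map_ofFn, List.sum_ofFn]
  simp only [Function.comp_apply]
  rw [Equiv.sum_comp σ fun i => dec (s.toList.get i), ← List.sum_ofFn]
  conv_rhs => rw [← Multiset.coe_toList s]
  simp only [valueSum, AddMonoidHom.coe_comp, Function.comp_apply, Multiset.coe_mapAddMonoidHom,
    Multiset.map_coe, Multiset.coe_sumAddMonoidHom, Multiset.sum_coe]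
  congr 1
  conv_rhs => rw [← List.ofFn_get s.toList, List.map_ofFn]
  rfl

/-- The messages with integer values up to `2 ^ (m + 1)` in absolute value can be decoded. -/
def Decodes (m : ℕ) : Prop := ∀ v : ℤ, |v| ≤ 2 ^ (m + 1) → dec (msg v) = v

variable {msg dec} {m : ℕ}

theorem valueSum_pairAtom (hdec : Decodes msg dec m) {j : ℕ} (hj : j ≤ m) : valueSum dec (pairAtom msg j) = 0 := by
  have h : (2 : ℤ) ^ j ≤ 2 ^ (m + 1) := pow_le_pow_right₀ one_le_two (by omega)
  rw [pairAtom, map_add, valueSum_singleton, valueSum_singleton, hdec, hdec, add_neg_cancel]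
  · rwa [abs_neg, abs_of_pos (by positivity)]
  · rwa [abs_of_pos (by positivity)]

theorem valueSum_splitAtom (hdec : Decodes msg dec m) {j : ℕ} (hj : j ≤ m) : valueSum dec (splitAtom msg j) = 0 := by
  have h : (2 : ℤ) ^ j ≤ 2 ^ (m + 1) := pow_le_pow_right₀ one_le_two (by omega)
  have h' : (2 : ℤ) ^ (j + 1) ≤ 2 ^ (m + 1) := pow_le_pow_right₀ one_le_two (by omega)
  rw [splitAtom, map_add, map_nsmul, valueSum_singleton, valueSum_singleton, hdec, hdec]
  · ring
  · rwa [abs_of_pos (by positivity)]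
  · rwa [abs_neg, abs_of_pos (by positivity)]

/-- Summing the values in `atom_identity` kills the pair and split atoms and leaves `x - x`, so
binary expansions need not be evaluated. -/
theorem valueSum_digitAtom (hdec : Decodes msg dec m) {x : ℕ} (hx : x ≤ 2 ^ m) : valueSum dec (digitAtom msg m x) = 0 := by
  have hlt : 2 ^ m < 2 ^ (m + 1) := Nat.pow_lt_pow_right one_lt_two m.lt_succ_self
  have h := congrArg (valueSum dec) (atom_identity msg (hx.trans_lt hlt))
  have hx' : |(x : ℤ)| ≤ 2 ^ (m + 1) := by
    rw [Nat.abs_cast]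
    exact_mod_cast (hx.trans_lt hlt).le
  have h1 : |(-1 : ℤ)| ≤ 2 ^ (m + 1) := by
    rw [abs_neg, abs_one]
    exact one_le_pow₀ one_le_two
  simp only [map_add, map_sum, map_nsmul, valueSum_singleton] at h
  rw [hdec _ hx', hdec _ h1,
    Finset.sum_eq_zero fun j hj => by
      rw [valueSum_splitAtom hdec (Nat.lt_succ_iff.1 (Finset.mem_range.1 hj)), smul_zero],
    Finset.sum_eq_zero fun j hj => by
      rw [valueSum_pairAtom hdec (Nat.lt_succ_iff.1 (Finset.mem_range.1 hj)), smul_zero]] at h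
  simpa using h.symm

theorem valueSum_atom (hdec : Decodes msg dec m) {i : ℕ ⊕ ℕ ⊕ ℕ} (hi : i ∈ atomIndex m) :
    valueSum dec (atom msg m i) = 0 := by
  rcases i with x | j | j
  · simp only [atomIndex, Finset.inl_mem_disjSum, Finset.mem_range] at hi
    exact valueSum_digitAtom hdec (Nat.lt_succ_iff.1 hi)
  · simp only [atomIndex, Finset.inr_mem_disjSum, Finset.inl_mem_disjSum, Finset.mem_range] at hi
    exact valueSum_pairAtom hdec (Nat.lt_succ_iff.1 hi)
  · simp only [atomIndex, Finset.inr_mem_disjSum, Finset.mem_range] at hi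
    exact valueSum_splitAtom hdec (Nat.lt_succ_iff.1 hi)

theorem mapHom_valueSum_totalNoise (hdec : Decodes msg dec m) (ha : 0 < a) (hb : 0 < b)
    (R : ℕ) :
    mapHom (valueSum dec) (totalNoise msg m ha hb R 1) =
      atomNoise 1 hb (1 : ℤ) * atomNoise 1 hb (-1) := by
  have h1 : |(1 : ℤ)| ≤ 2 ^ (m + 1) := by
    rw [abs_one]
    exact one_le_pow₀ one_le_two
  rw [totalNoise, map_mul, map_mul, flood, map_prod, Finset.prod_eq_one, one_mul,
    mapHom_atomNoise, mapHom_atomNoise, valueSum_singleton, valueSum_singleton, hdec _ h1,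
    hdec _ (by rwa [abs_neg])]
  intro i hi
  rw [mapHom_atomNoise, valueSum_atom hdec hi, atomNoise_zero]

theorem mapHom_valueSum_roundLaw (hdec : Decodes msg dec m) {y : ℝ}
    (hy : y ≤ ((2 ^ m : ℕ) : ℝ)) :
    mapHom (valueSum dec) ((roundLaw y).map fun k : ℕ => ({msg k} : Multiset M)) =
      (roundLaw y).map fun k : ℕ => (k : ℤ) := by
  refine pmf_ext_expect fun f => ?_
  rw [mapHom_apply, expect_map, expect_map, expect_map]
  refine tsum_congr fun k => ?_
  by_cases hk : roundLaw y k = 0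
  · rw [hk, zero_mul, zero_mul]
  · have hk' := le_of_mem_support_roundLaw hy hk
    have hlt : 2 ^ m < 2 ^ (m + 1) := Nat.pow_lt_pow_right one_lt_two m.lt_succ_self
    beta_reduce
    rw [valueSum_singleton, hdec]
    rw [Nat.abs_cast]
    exact_mod_cast (hk'.trans_lt hlt).le

theorem mse_sumProtocol_le (hdec : Decodes msg dec m) (ha : 0 < a) (hb : 0 < b) (R : ℕ) {n : ℕ}
    (hn : n ≠ 0) (x : Fin n → Set.Icc (0 : ℝ) 1) :
    mse ((sumProtocol msg dec m ha hb R n).output x).toMeasure (realSum x) ≤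
      ENNReal.ofReal ((2 / b ^ 2 + n / 4) / (2 ^ m) ^ 2) := by
  have hle : ∀ z : Set.Icc (0 : ℝ) 1, (z : ℝ) * 2 ^ m ≤ ((2 ^ m : ℕ) : ℝ) := fun z => by
    push_cast
    exact mul_le_of_le_one_left (by positivity) z.2.2
  have hpos : ∀ i, 0 ≤ (x i : ℝ) * 2 ^ m := fun i => mul_nonneg (x i).2.1 (by positivity)
  set μ := collect (sumProtocol msg dec m ha hb R n).randomizer n x with hμ
  have hlaw : μ.map (valueSum dec) =
      (∏ i, (roundLaw (x i * 2 ^ m)).map fun k : ℕ => (k : ℤ)) *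
        (atomNoise 1 hb (1 : ℤ) * atomNoise 1 hb (-1)) := by
    rw [hμ, collect_sumProtocol msg dec m ha hb R hn, ← mapHom_apply, map_mul, map_prod,
      mapHom_valueSum_totalNoise hdec]
    congr 1
    exact Finset.prod_congr rfl fun i _ => mapHom_valueSum_roundLaw hdec (hle _)
  have hsum : realSum x * 2 ^ m = ∑ i, (x i : ℝ) * 2 ^ m := by rw [realSum, Finset.sum_mul]
  have hscale : ∀ t : ℤ, ENNReal.ofReal (((t : ℝ) / 2 ^ m - realSum x) ^ 2) =
      ENNReal.ofReal (1 / (2 ^ m) ^ 2) * ENNReal.ofReal ((t - realSum x * 2 ^ m) ^ 2) := by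
    intro t
    rw [← ENNReal.ofReal_mul (by positivity)]
    congr 1
    field_simp
  rw [mse_toMeasure, Protocol.output, expect_map, Protocol.view, expect_bind, ← hμ]
  simp only [sumProtocol]
  calc expect μ (fun s => expect (shuffle s) fun l =>
        ENNReal.ofReal ((((l.map dec).sum : ℤ) / 2 ^ m - realSum x) ^ 2))
      = expect μ fun s =>
        ENNReal.ofReal (((valueSum dec s : ℤ) / 2 ^ m - realSum x) ^ 2) := by
        congr 1
        funext s
        exact expect_shuffle_valueSum dec s fun t =>
          ENNReal.ofReal (((t : ℝ) / 2 ^ m - realSum x) ^ 2)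
    _ = ENNReal.ofReal (1 / (2 ^ m) ^ 2) *
        sqDev (μ.map (valueSum dec)) (∑ i, (x i : ℝ) * 2 ^ m) := by
        simp only [hscale, expect_mul_left, sqDev, expect_map, hsum]
    _ ≤ ENNReal.ofReal (1 / (2 ^ m) ^ 2) *
        (ENNReal.ofReal (2 / b ^ 2) + n * ENNReal.ofReal (1 / 4)) := by
        gcongr
        rw [hlaw]
        refine (sqDev_prod_roundLaw_mul_le Finset.univ _ hpos).trans ?_
        rw [Finset.card_univ, Fintype.card_fin]
        gcongr
        exact sqDev_central_le hb
    _ = _ := by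
        rw [← ENNReal.ofReal_natCast, ← ENNReal.ofReal_mul (by positivity),
          ← ENNReal.ofReal_add (by positivity) (by positivity),
          ← ENNReal.ofReal_mul (by positivity)]
        congr 1
        ring

end Analysis

/-! ### Expected number of messages -/

section ExpectedMessages

variable {M : Type*} (msg : ℤ → M) (dec : M → ℤ) {a b : ℝ}

/-- The size of a multiset, as an extended nonnegative real. -/
def sizeHom (M : Type*) : Multiset M →+ ℝ≥0∞ :=
  (Nat.castAddMonoidHom ℝ≥0∞).comp Multiset.cardHom

theorem sizeHom_apply (s : Multiset M) : sizeHom M s = (Multiset.card s : ℝ≥0∞) := rfl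

theorem expect_atomNoise_size_le (r : ℝ≥0) (ha : 0 < a) (g : Multiset M) :
    expect (atomNoise r ha g) (sizeHom M) ≤ ENNReal.ofReal (r * (1 / a) * Multiset.card g) := by
  have h : expect (atomNoise r ha g) (sizeHom M) =
      r * geomMean (expNeg a) * Multiset.card g := by
    rw [atomNoise, expect_map, ← expect_nb_id (expNeg_lt_one ha), ← expect_mul_right]
    congr 1
    funext k
    rw [map_nsmul, sizeHom_apply, nsmul_eq_mul]
  rw [h, ENNReal.ofReal_mul (by positivity), ENNReal.ofReal_mul (by positivity),
    ENNReal.ofReal_coe_nnreal, ENNReal.ofReal_natCast]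
  gcongr
  exact geomMean_expNeg_le ha

theorem card_digitAtom_le (m x : ℕ) : Multiset.card (digitAtom msg m x) ≤ m + 2 := by
  simp only [digitAtom, Multiset.card_add, Multiset.card_singleton, Multiset.card_sum,
    Multiset.card_nsmul, mul_one]
  have h : ∑ j ∈ Finset.range (m + 1), x / 2 ^ j % 2 ≤ ∑ _j ∈ Finset.range (m + 1), 1 :=
    Finset.sum_le_sum fun j _ => Nat.lt_succ_iff.1 (Nat.mod_lt _ two_pos)
  simp only [Finset.sum_const, Finset.card_range, smul_eq_mul, mul_one] at h
  omega

theorem sum_two_pow_sub_le (m : ℕ) : ∑ j ∈ Finset.range (m + 1), 2 ^ (m - j) ≤ 2 * 2 ^ m := by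
  have h := Finset.sum_range_reflect (fun j => 2 ^ j) (m + 1)
  simp only [Nat.add_sub_cancel] at h
  rw [h, Nat.geomSum_eq le_rfl]
  simp only [Nat.add_one_sub_one, Nat.div_one, pow_succ]
  omega

/-- The mean number of copies of an atom is at most proportional to its cap. The many digit atoms
have cap `1`, and the caps of pair and split atoms decay geometrically, so the weighted size is `2 ^
m` up to a factor linear in `m`. -/
theorem sum_atomCap_mul_card_le (m : ℕ) :
    ∑ i ∈ atomIndex m, atomCap m i * Multiset.card (atom msg m i) ≤ 2 ^ m * (2 * m + 24) := by
  have h1 : ∀ j, Multiset.card (pairAtom msg j) = 2 := fun j => by simp [pairAtom]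
  have h2 : ∀ j, Multiset.card (splitAtom msg j) = 3 := fun j => by simp [splitAtom]
  have h3 : ∑ x ∈ Finset.range (2 ^ m + 1), Multiset.card (digitAtom msg m x) ≤
      (2 ^ m + 1) * (m + 2) := by
    refine (Finset.sum_le_sum fun x _ => card_digitAtom_le msg m x).trans (le_of_eq ?_)
    simp
  have h4 := sum_two_pow_sub_le m
  have h5 : 1 ≤ 2 ^ m := Nat.one_le_two_pow
  simp only [atomIndex, Finset.sum_disjSum, atomCap, atom, Sum.elim_inl, Sum.elim_inr, one_mul, h1,
    h2, ← Finset.sum_mul, ← Finset.mul_sum]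
  nlinarith

theorem expect_flood_size_le {m : ℕ} (ha : 0 < a) (r : ℝ≥0) :
    expect (flood (atomIndex m) (atom msg m) (atomCap m) (atomCap_pos m) ha r) (sizeHom M) ≤
      ENNReal.ofReal (r * (1 / a) * (2 ^ m * (2 * m + 24))) := by
  rw [flood, expect_hom_prod]
  refine (Finset.sum_le_sum fun i _ => expect_atomNoise_size_le r _ _).trans ?_
  rw [← ENNReal.ofReal_sum_of_nonneg fun i _ => by positivity]
  refine ENNReal.ofReal_le_ofReal ?_
  have h : ((∑ i ∈ atomIndex m, atomCap m i * Multiset.card (atom msg m i) : ℕ) : ℝ) ≤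
      ((2 ^ m * (2 * m + 24) : ℕ) : ℝ) := Nat.cast_le.2 (sum_atomCap_mul_card_le msg m)
  push_cast at h
  calc _ = r * (1 / a) * ∑ i ∈ atomIndex m, (atomCap m i : ℝ) * Multiset.card (atom msg m i) := by
        rw [Finset.mul_sum]
        refine Finset.sum_congr rfl fun i _ => ?_
        rw [one_div_div]
        ring
    _ ≤ _ := by gcongr

theorem expectedMessages_sumProtocol_le (m : ℕ) (ha : 0 < a) (hb : 0 < b) (R n : ℕ)
    (x : Set.Icc (0 : ℝ) 1) :
    (sumProtocol msg dec m ha hb R n).expectedMessages x ≤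
      ENNReal.ofReal (1 + (R * (1 / a) * (2 ^ m * (2 * m + 24)) + 2 / b) / n) := by
  change expect ((roundLaw (x * 2 ^ m)).map (fun k : ℕ => ({msg k} : Multiset M)) *
    totalNoise msg m ha hb R (n : ℝ≥0)⁻¹) (sizeHom M) ≤ _
  have h1 : expect ((roundLaw (x * 2 ^ m)).map (fun k : ℕ => ({msg k} : Multiset M)))
      (sizeHom M) = ENNReal.ofReal 1 := by
    rw [expect_map]
    simp only [sizeHom_apply, Multiset.card_singleton, Nat.cast_one, expect_const,
      ENNReal.ofReal_one]
  rw [expect_hom_mul, h1, totalNoise, expect_hom_mul, expect_hom_mul]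
  have h2 := expect_flood_size_le msg (m := m) ha ((n : ℝ≥0)⁻¹ * R)
  have h3 := expect_atomNoise_size_le (n : ℝ≥0)⁻¹ hb ({msg 1} : Multiset M)
  have h4 := expect_atomNoise_size_le (n : ℝ≥0)⁻¹ hb ({msg (-1)} : Multiset M)
  refine (add_le_add_right (add_le_add h2 (add_le_add h3 h4)) _).trans (le_of_eq ?_)
  rw [← ENNReal.ofReal_add (by positivity) (by positivity),
    ← ENNReal.ofReal_add (by positivity) (by positivity),
    ← ENNReal.ofReal_add (by positivity) (by positivity)]
  congr 1
  simp only [NNReal.coe_mul, NNReal.coe_inv, NNReal.coe_natCast, Multiset.card_singleton,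
    Nat.cast_one]
  ring

end ExpectedMessages

/-! ### Encoding and choice of parameters -/

/-- The `2 ^ (m + 2) + 1` integers in the range fit into `2 ^ (m + 3)` strings. The range extends to
`2 ^ (m + 1)` because of the topmost split atom. -/
theorem exists_decodes (m : ℕ) :
    ∃ (msg : ℤ → Fin (m + 3) → Bool) (dec : (Fin (m + 3) → Bool) → ℤ), Decodes msg dec m := by
  have hcard : Fintype.card (Finset.Icc (-2 ^ (m + 1) : ℤ) (2 ^ (m + 1))) ≤
      Fintype.card (Fin (m + 3) → Bool) := by
    have h : (1 : ℤ) ≤ 2 ^ (m + 1) := one_le_pow₀ one_le_two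
    simp only [Fintype.card_coe, Int.card_Icc, Fintype.card_pi, Fintype.card_bool,
      Finset.prod_const, Finset.card_univ, Fintype.card_fin]
    rw [Int.toNat_le]
    push_cast
    have e : (2 : ℤ) ^ (m + 3) = 4 * 2 ^ (m + 1) := by ring
    linarith
  obtain ⟨e⟩ := Function.Embedding.nonempty_of_card_le hcard
  let g : ℤ → Fin (m + 3) → Bool := fun v =>
    if h : v ∈ Finset.Icc (-2 ^ (m + 1) : ℤ) (2 ^ (m + 1)) then e ⟨v, h⟩ else fun _ => false
  have hg : Set.InjOn g (Finset.Icc (-2 ^ (m + 1) : ℤ) (2 ^ (m + 1))) := by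
    intro v hv w hw h
    have hv' : v ∈ Finset.Icc (-2 ^ (m + 1) : ℤ) (2 ^ (m + 1)) := hv
    have hw' : w ∈ Finset.Icc (-2 ^ (m + 1) : ℤ) (2 ^ (m + 1)) := hw
    simp only [g, dif_pos hv', dif_pos hw'] at h
    exact congrArg Subtype.val (e.injective h)
  refine ⟨g, Function.invFunOn g (Finset.Icc (-2 ^ (m + 1) : ℤ) (2 ^ (m + 1))), fun v hv => ?_⟩
  exact hg.leftInvOn_invFunOn (Finset.mem_coe.2 (Finset.mem_Icc.2 (abs_le.1 hv)))

end

/-- The grid size is the power of two just above `√n * (E + 1) / ζ`. As `ζ < 1 / 2`, the number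
`logb 2 (1 / ζ)` is at least `1` and absorbs additive constants in the bit count. -/
theorem exists_scale {n : ℕ} (hn : 1 ≤ n) {E ζ : ℝ} (hE : 0 < E) (hζ : 0 < ζ) (hζ2 : ζ < 1 / 2) :
    ∃ m : ℕ, √n * (E + 1) / ζ ≤ 2 ^ m ∧ (2 : ℝ) ^ m ≤ 2 * (√n * (E + 1) / ζ) ∧
      (m : ℝ) + 3 ≤ 1 / 2 * Real.logb 2 n + (5 + Real.logb 2 (E + 1)) * Real.logb 2 (1 / ζ) ∧
      4 * (m : ℝ) + 6 ≤ (26 + 8 * E) * (1 + Real.log n + 1 / ζ) := by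
  have hn' : (1 : ℝ) ≤ n := by exact_mod_cast hn
  have hn0 : (0 : ℝ) < n := by linarith
  have hs : 1 ≤ √(n : ℝ) := Real.one_le_sqrt.2 hn'
  have hs0 : 0 < √(n : ℝ) := by linarith
  have hX1 : 1 ≤ √n * (E + 1) / ζ := by
    rw [le_div_iff₀ hζ]
    nlinarith
  obtain ⟨k, hk1, hk2⟩ := exists_nat_pow_near hX1 (one_lt_two : (1 : ℝ) < 2)
  have hlogX : Real.log (√n * (E + 1) / ζ) =
      1 / 2 * Real.log n + Real.log (E + 1) + Real.log (1 / ζ) := by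
    rw [div_eq_mul_one_div, Real.log_mul (by positivity) (by positivity),
      Real.log_mul (by positivity) (by positivity), Real.log_sqrt hn0.le]
    ring
  have hk : (k : ℝ) * Real.log 2 ≤
      1 / 2 * Real.log n + Real.log (E + 1) + Real.log (1 / ζ) := by
    rw [← hlogX, ← Real.log_pow]
    exact Real.log_le_log (by positivity) hk1
  have hl2 : 0 < Real.log 2 := Real.log_pos one_lt_two
  have hlE : 0 ≤ Real.log (E + 1) := Real.log_nonneg (by linarith)
  have hlz : Real.log 2 ≤ Real.log (1 / ζ) := by
    refine Real.log_le_log two_pos ?_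
    rw [le_div_iff₀ hζ]
    linarith
  have hln : 0 ≤ Real.log n := Real.log_nonneg hn'
  refine ⟨k + 1, hk2.le, ?_, ?_, ?_⟩
  · rw [pow_succ]
    linarith
  · have h1 : (k : ℝ) ≤ 1 / 2 * Real.logb 2 n + Real.logb 2 (E + 1) + Real.logb 2 (1 / ζ) := by
      simp only [Real.logb, mul_div_assoc', ← add_div]
      rw [le_div_iff₀ hl2]
      exact hk
    have h2 : 1 ≤ Real.logb 2 (1 / ζ) := by rwa [Real.logb, one_le_div hl2]
    have h3 : 0 ≤ Real.logb 2 (E + 1) := div_nonneg hlE hl2.le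
    push_cast
    nlinarith
  · have h1 : (k : ℝ) * (1 / 2) ≤ k * Real.log 2 := by
      gcongr
      linarith [Real.log_two_gt_d9]
    have h2 := Real.log_le_sub_one_of_pos (show 0 < E + 1 by linarith)
    have h3 := Real.log_le_sub_one_of_pos (show 0 < 1 / ζ by positivity)
    have hz : 0 < 1 / ζ := by positivity
    push_cast
    nlinarith [mul_nonneg hE.le hln, mul_nonneg hE.le hz.le]

theorem laplace_slack {ζ ε E D : ℝ} {n : ℕ} (hζ : 0 < ζ) (hζ2 : ζ < 1 / 2) (hε : 0 < ε)
    (hεE : ε ≤ E) (hD0 : 0 < D) (hD : √n * (E + 1) / ζ ≤ D) :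
    (2 / ((1 - ζ / 2) * ε / D) ^ 2 + n / 4) / D ^ 2 ≤ 2 / ((1 - ζ) * ε) ^ 2 := by
  have hu : 0 < 1 - ζ / 2 := by linarith
  have hw : 0 < 1 - ζ := by linarith
  have h1 : (n : ℝ) * ε ^ 2 ≤ ζ ^ 2 * D ^ 2 := by
    have h2 : √(n : ℝ) * ε ≤ ζ * D := by
      rw [div_le_iff₀ hζ] at hD
      have : √(n : ℝ) * ε ≤ √n * (E + 1) := by gcongr; linarith
      linarith
    have h3 : (√(n : ℝ) * ε) ^ 2 ≤ (ζ * D) ^ 2 := by gcongr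
    rwa [mul_pow, mul_pow, Real.sq_sqrt (Nat.cast_nonneg n)] at h3
  have h4 : (n : ℝ) / 4 / D ^ 2 ≤ ζ ^ 2 / 4 / ε ^ 2 := by
    rw [div_div, div_div, div_le_div_iff₀ (by positivity) (by positivity)]
    linarith
  have h5 : 2 / (1 - ζ / 2) ^ 2 + ζ ^ 2 / 4 ≤ 2 / (1 - ζ) ^ 2 := by
    have hu1 : (1 - ζ / 2) ^ 2 ≤ 1 := pow_le_one₀ hu.le (by linarith)
    have hw1 : (1 - ζ) ^ 2 ≤ 1 := pow_le_one₀ hw.le (by linarith)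
    have hprod : (1 - ζ / 2) ^ 2 * (1 - ζ) ^ 2 ≤ 1 := mul_le_one₀ hu1 (by positivity) hw1
    rw [div_add' _ _ _ (by positivity), div_le_div_iff₀ (by positivity) (by positivity)]
    have h6 : ζ ^ 2 / 4 * ((1 - ζ / 2) ^ 2 * (1 - ζ) ^ 2) ≤ ζ ^ 2 / 4 * 1 := by gcongr
    nlinarith
  calc (2 / ((1 - ζ / 2) * ε / D) ^ 2 + n / 4) / D ^ 2
      = 2 / (1 - ζ / 2) ^ 2 / ε ^ 2 + n / 4 / D ^ 2 := by
        field_simp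
    _ ≤ 2 / (1 - ζ / 2) ^ 2 / ε ^ 2 + ζ ^ 2 / 4 / ε ^ 2 := by gcongr
    _ = (2 / (1 - ζ / 2) ^ 2 + ζ ^ 2 / 4) / ε ^ 2 := by rw [add_div]
    _ ≤ 2 / (1 - ζ) ^ 2 / ε ^ 2 := by gcongr
    _ = 2 / ((1 - ζ) * ε) ^ 2 := by rw [div_div, mul_pow]

/-- The factor `3 * J` pays for the at most `J` shifted atoms and for an exponential factor of at
most `exp 1 < 3`. -/
theorem exists_shape {J δ : ℝ} (hJ : 6 ≤ J) (hδ : 0 < δ) (hδ2 : δ < 1 / 2) :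
    ∃ R : ℕ, 10 ≤ R ∧ Real.exp (-(R / 4)) ≤ δ / (3 * J) ∧
      (R : ℝ) ≤ 30 * J * Real.log (1 / δ) := by
  have hL : 1 / 2 ≤ Real.log (1 / δ) := by
    have h1 : Real.log 2 ≤ Real.log (1 / δ) := by
      refine Real.log_le_log two_pos ?_
      rw [le_div_iff₀ hδ]
      linarith
    linarith [Real.log_two_gt_d9]
  have hlog : Real.log (3 * J / δ) ≤ 3 * J + Real.log (1 / δ) := by
    rw [div_eq_mul_one_div, Real.log_mul (by positivity) (by positivity)]
    linarith [Real.log_le_sub_one_of_pos (show 0 < 3 * J by positivity)]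
  have hlog0 : 0 ≤ Real.log (3 * J / δ) := by
    refine Real.log_nonneg ?_
    rw [le_div_iff₀ hδ]
    linarith
  refine ⟨⌈4 * Real.log (3 * J / δ)⌉₊ + 10, by omega, ?_, ?_⟩
  · have h1 := Nat.le_ceil (4 * Real.log (3 * J / δ))
    have h2 : δ / (3 * J) = Real.exp (-Real.log (3 * J / δ)) := by
      rw [← Real.log_inv, inv_div, Real.exp_log (by positivity)]
    rw [h2, Real.exp_le_exp]
    push_cast
    linarith
  · have h1 := (Nat.ceil_lt_add_one (by positivity : 0 ≤ 4 * Real.log (3 * J / δ))).le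
    push_cast
    nlinarith

theorem message_bound {J L E ζ ε D R m W : ℝ} {n : ℕ} (hn : 1 ≤ n) (hJm : J = 4 * m + 6)
    (hm : 0 ≤ m) (hL : 1 / 2 ≤ L) (hE : 0 < E) (hζ : 0 < ζ) (hζ2 : ζ < 1 / 2) (hε : 0 < ε)
    (hR : R ≤ 30 * J * L) (hD0 : 0 < D) (hD : D ≤ 2 * (√n * (E + 1) / ζ))
    (hJ : J ≤ (26 + 8 * E) * W) (hWε : 1 / ε ≤ W) (hWζ : 1 / ζ ≤ W) :
    (R * (1 / (ζ * ε / (2 * (E + 1)) / (9 * J))) * (D * (2 * m + 24)) +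
        2 / ((1 - ζ / 2) * ε / D)) / n ≤
      4336 * (E + 1) ^ 2 * (26 + 8 * E) ^ 3 * W ^ 6 * (L / √n) := by
  have hJ6 : 6 ≤ J := by linarith
  have hn' : (1 : ℝ) ≤ n := by exact_mod_cast hn
  have hs0 : 0 < √(n : ℝ) := Real.sqrt_pos.2 (by linarith)
  have hss : √(n : ℝ) * √n = n := Real.mul_self_sqrt (by linarith)
  have hW : 0 < W := lt_of_lt_of_le (by positivity) hWε
  have h1 : R * (1 / (ζ * ε / (2 * (E + 1)) / (9 * J))) * (D * (2 * m + 24)) ≤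
      2160 * ((E + 1) * J ^ 3 * L * (1 / ζ) * (1 / ε) * D) := by
    calc R * (1 / (ζ * ε / (2 * (E + 1)) / (9 * J))) * (D * (2 * m + 24))
        ≤ 30 * J * L * (1 / (ζ * ε / (2 * (E + 1)) / (9 * J))) * (D * (4 * J)) := by
          gcongr
          linarith
      _ = _ := by field_simp; ring
  have h2 : 2 / ((1 - ζ / 2) * ε / D) ≤ 8 * ((E + 1) * J ^ 3 * L * (1 / ζ) * (1 / ε) * D) := by
    have h3 : 2 / ((1 - ζ / 2) * ε / D) = 2 / (1 - ζ / 2) * ((1 / ε) * D) := by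
      have : 0 < 1 - ζ / 2 := by linarith
      field_simp
    have h4 : 2 / (1 - ζ / 2) ≤ 4 := by
      rw [div_le_iff₀ (by linarith)]
      linarith
    have h5 : 1 / 2 ≤ (E + 1) * J ^ 3 * L * (1 / ζ) := by
      have e1 : 1 ≤ E + 1 := by linarith
      have e2 : 1 ≤ J ^ 3 := one_le_pow₀ (by linarith)
      have e3 : 1 ≤ 1 / ζ := by rw [le_div_iff₀ hζ]; linarith
      calc (1 : ℝ) / 2 = 1 * 1 * (1 / 2) * 1 := by norm_num
        _ ≤ _ := by gcongr
    calc 2 / ((1 - ζ / 2) * ε / D) ≤ 4 * ((1 / ε) * D) := by rw [h3]; gcongr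
      _ = 8 * ((1 / 2) * (1 / ε) * D) := by ring
      _ ≤ _ := by gcongr
  calc _ ≤ (2160 * ((E + 1) * J ^ 3 * L * (1 / ζ) * (1 / ε) * D) +
        8 * ((E + 1) * J ^ 3 * L * (1 / ζ) * (1 / ε) * D)) / n := by gcongr
    _ = 2168 * ((E + 1) * J ^ 3 * L * (1 / ζ) * (1 / ε) * D) / n := by ring
    _ ≤ 2168 * ((E + 1) * ((26 + 8 * E) * W) ^ 3 * L * W * W *
        (2 * (√n * (E + 1) * W))) / n := by
        gcongr
        refine hD.trans ?_
        rw [div_eq_mul_one_div]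
        gcongr
    _ = _ := by
        generalize √(n : ℝ) = s at hs0 hss
        rw [← hss]
        field_simp
        ring

end ShuffleDP

/-! ### Assembly -/

theorem theorem1 :
    ∃ k : ℕ, ∀ E : ℝ, 0 < E → ∃ C : ℝ, 0 < C ∧
      ∀ (n : ℕ) (ε ζ δ : ℝ), 1 ≤ n → 0 < ε → ε ≤ E →
        0 < ζ → ζ < 1 / 2 → 0 < δ → δ < 1 / 2 →
        ∃ b : ℕ, (b : ℝ) ≤ 1 / 2 * Real.logb 2 n + C * Real.logb 2 (1 / ζ) ∧
          ∃ P : ShuffleDP.Protocol (Set.Icc (0 : ℝ) 1) (Fin b → Bool),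
            P.IsShuffleDP n ε δ ∧
            (∀ x : Fin n → Set.Icc (0 : ℝ) 1,
              ShuffleDP.mse (P.output x).toMeasure (ShuffleDP.realSum x) ≤
                ShuffleDP.mse (ShuffleDP.laplaceMechanism ((1 - ζ) * ε) x)
                  (ShuffleDP.realSum x)) ∧
            ∀ a : Set.Icc (0 : ℝ) 1,
              P.expectedMessages a ≤
                ENNReal.ofReal (1 + C * (1 + Real.log n + 1 / ε + 1 / ζ) ^ k
                  * (Real.log (1 / δ) / Real.sqrt n)) := by
  -- The exponent collects `J ^ 3` (from the shape `R`, from `1 / a` and from the atom sizes), one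
  -- factor `1 / ε`, and two factors `1 / ζ`, from `1 / a` and from the grid size.
  refine ⟨6, fun E hE => ?_⟩
  have hlE : 0 ≤ Real.logb 2 (E + 1) := Real.logb_nonneg one_lt_two (by linarith)
  set K := 4336 * (E + 1) ^ 2 * (26 + 8 * E) ^ 3 with hK
  have hK0 : 0 < K := by positivity
  refine ⟨K + (5 + Real.logb 2 (E + 1)), by positivity, ?_⟩
  intro n ε ζ δ hn hε hεE hζ hζ2 hδ hδ2
  obtain ⟨m, hD, hD2, hbits, hJW⟩ := ShuffleDP.exists_scale hn hE hζ hζ2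
  obtain ⟨R, hR10, hRδ, hRJ⟩ :=
    ShuffleDP.exists_shape (J := 4 * (m : ℝ) + 6) (by linarith [m.cast_nonneg (α := ℝ)]) hδ hδ2
  obtain ⟨msg, dec, hdec⟩ := ShuffleDP.exists_decodes m
  have hn0 : n ≠ 0 := by omega
  have hm0 : (0 : ℝ) ≤ m := m.cast_nonneg
  have hln : 0 ≤ Real.log n := Real.log_nonneg (by exact_mod_cast hn)
  have hz1 : 1 ≤ 1 / ζ := by rw [le_div_iff₀ hζ]; linarith
  have hlz : 0 ≤ Real.logb 2 (1 / ζ) := Real.logb_nonneg one_lt_two hz1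
  have he0 : 0 < 1 / ε := by positivity
  have hL : 1 / 2 ≤ Real.log (1 / δ) := by
    have h1 : Real.log 2 ≤ Real.log (1 / δ) := by
      refine Real.log_le_log two_pos ?_
      rw [le_div_iff₀ hδ]
      linarith
    linarith [Real.log_two_gt_d9]
  have hu : 0 < 1 - ζ / 2 := by linarith
  set J : ℝ := 4 * m + 6 with hJ
  have hJ6 : 6 ≤ J := by linarith
  -- The privacy budget of the flooding noise: at most `ζ * ε / 2`, the part not used by the central
  -- noise, and, thanks to `E + 1`, at most `1`, which bounds the factor in the additive error.
  set e : ℝ := ζ * ε / (2 * (E + 1)) with he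
  have hepos : 0 < e := by positivity
  have he1 : e ≤ 1 := by
    rw [he, div_le_one (by positivity)]
    nlinarith
  have he2 : e ≤ ζ * ε / 2 := by
    rw [he]
    gcongr
    linarith
  have ha : 0 < e / (9 * J) := by positivity
  have ha4 : e / (9 * J) ≤ 1 / 4 := by
    rw [div_le_iff₀ (by positivity)]
    linarith
  have hb : 0 < (1 - ζ / 2) * ε / 2 ^ m := by positivity
  have haJ : 9 * (e / (9 * J)) * J = e := by field_simp
  refine ⟨m + 3, ?_, ShuffleDP.sumProtocol msg dec m ha hb R n, ?_, fun x => ?_, fun x => ?_⟩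
  · push_cast
    nlinarith [mul_nonneg hK0.le hlz]
  · refine ShuffleDP.isShuffleDP_sumProtocol msg dec ha ha4 hb hR10 hn0 ?_ ?_
    · rw [← hJ, haJ, div_mul_cancel₀ _ (by positivity)]
      linarith
    · have h1 : Real.exp (9 * (e / (9 * J)) * (2 * m + 3)) ≤ 3 := by
        have h2 : 9 * (e / (9 * J)) * (2 * m + 3) ≤ 1 := by
          refine le_trans ?_ (haJ.le.trans he1)
          gcongr
          linarith
        exact (Real.exp_le_exp.2 h2).trans (by linarith [Real.exp_one_lt_d9])
      calc _ ≤ J * 3 * (δ / (3 * J)) := by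
            gcongr
            linarith
        _ = δ := by field_simp
  · have ha' : 0 < (1 - ζ) * ε := mul_pos (by linarith) hε
    refine (ShuffleDP.mse_sumProtocol_le hdec ha hb R hn0 x).trans
      (le_trans ?_ (ShuffleDP.le_mse_laplaceMechanism ha' x))
    exact ENNReal.ofReal_le_ofReal
      (ShuffleDP.laplace_slack hζ hζ2 hε hεE (by positivity) hD)
  · refine (ShuffleDP.expectedMessages_sumProtocol_le msg dec m ha hb R n x).trans
      (ENNReal.ofReal_le_ofReal ?_)
    have h := ShuffleDP.message_bound (W := 1 + Real.log n + 1 / ε + 1 / ζ) hn hJ hm0 hL hE hζ hζ2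
      hε hRJ (by positivity : (0 : ℝ) < 2 ^ m) hD2
      (hJW.trans (mul_le_mul_of_nonneg_left (by linarith) (by positivity))) (by linarith) (by linarith)
    refine (add_le_add_right h 1).trans ?_
    gcongr
    linarith
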